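/- **Setting.** Let $\mathcal M=(\mathcal S,\mathcal A,\{P_h\}_{h=0}^{H-1},\{r_h\}_{h=0}^{H-1},H)$ be a finite-horizon time-dependent Markov decision process with finite state space $\mathcal S$ and finite nonempty action space $\mathcal A$ ($S=|\mathcal S|$, $A=|\mathcal A|$), transition probabilities $P_h(s'|s,a)$ and rewards $r_h(s,a)\in[0,1]$. A policy is a map $\pi:\mathcal S\times\{0,\dots,H-1\}\to\mathcal A$; its value is $V^\pi_h(s)=\mathbb E\big[\sum_{t=h}^{H-1}r_t(s_t,\pi(s_t,t))\,\big|\,\pi,s_h=s\big]$, the optimal value is $V^*_h(s)=\max_\pi V^\pi_h(s)$, and $\pi$ is optimal if $V^\pi_0=V^*_0$. Real numbers are stored in quantum registers of $q$ qubits in fixed-point binary representation $\mathrm{Bi}[x]$ with precision $2^{-p}$. A quantum oracle of $\mathcal M$ is a unitary $O$ with $O|s\rangle|a\rangle|h\rangle|s'\rangle|0\rangle|0\rangle=|s\rangle|a\rangle|h\rangle|s'\rangle|\mathrm{Bi}[r_h(s,a)]\rangle|\mathrm{Bi}[P_h(s'|s,a)]\rangle$; a quantum oracle of a vector $v\in\mathbb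 R^{\mathcal S}$ is a unitary $U_v$ with $U_v|s\rangle|0\rangle=|s\rangle|\mathrm{Bi}[v(s)]\rangle$. **Quantum maximum searching.** $\mathrm{QMS}_\zeta$ with constant $c>0$, applied to a unitary that writes the entries of a list of $N$ numbers, runs $\lceil\log_2(1/\zeta)\rceil$ independent copies of the Dürr–Høyer search (a uniformly random initial threshold index; rounds of Grover search with a random number $j<m$ of iterations for an entry exceeding the current threshold, $m$ starting from $1$, multiplied by $6/5$ up to $\sqrt N$ after a failure and reset to $1$ after a success), each interrupted after at most $\lceil c\sqrt N\,\rceil$ queries to the unitary or its inverse, and returns the best index found. **Algorithm QVI-1$(\mathcal M,\delta)$.** Put $\zeta=\delta/(SH)$ and $\hat V_H=0$. For $h=H-1,\dots,0$ and every $s\in\mathcal S$: build from $O$ and $U_{\hat V_{h+1}}$ the circuit that maps $|a\rangle$ with blank ancillas to $|a\rangle$ together with the fixed-point value of $\hat Q_{h,s}(a)=r_h(s,a)+\sum_{s'}P_h(s'|s,a)\hat V_{h+1}(s')$; let $\hat\pi(s,h)$ be the output of $\mathrm{QMS}_\zeta$ on this circuit; put $\hat V_h(s)=\hat Q_{h,s}(\hat\pi(s,h))$.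 Return $\hat\pi$ and $\hat V_0$. **Theorem (correctness of QVI-1).** There is an absolute constant $c>0$ such that the following holds for QVI-1 run with this constant in QMS. For every $\mathcal M$ as above there is $p_0=p_0(\mathcal M)$ such that for all numbers of bits $p\ge p_0$ and $q$ with $H\,2^p<2^q$ (the precision is sufficiently large and no number in $[0,H]$ overflows), for every quantum oracle $O$ of $\mathcal M$, all choices of oracles $U_v$ of the vectors $v\in\mathbb R^{\mathcal S}$, and every $\delta\in(0,1)$: with probability at least $1-\delta$, the outputs of QVI-1$(\mathcal M,\delta)$ satisfy that $\hat\pi$ is an optimal policy and $\hat V_0=V^*_0$. -/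

import Mathlib

open scoped Kronecker

namespace QVI

/-! ### Finite-horizon, time-dependent Markov decision processes -/

/-- A finite-horizon time-dependent MDP with state space `S`, action space `A`, horizon `H`:
`P h s a s'` is the probability of moving from `s` to `s'` under the action `a` at time `h`, and
`r h s a` is the reward collected at time `h`. -/
structure MDP (S A : Type*) [Fintype S] (H : ℕ) where
  P : Fin H → S → A → S → ℝ
  r : Fin H → S → A → ℝ
  P_nonneg : ∀ h s a s', 0 ≤ P h s a s'
  P_sum : ∀ h s a, ∑ s', P h s a s' = 1
  r_nonneg : ∀ h s a, 0 ≤ r h s a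
  r_le_one : ∀ h s a, r h s a ≤ 1

/-- Deterministic time-dependent policies. -/
abbrev Policy (S A : Type*) (H : ℕ) : Type _ := S → Fin H → A

section Values

variable {S A : Type*} [Fintype S] [DecidableEq S] {H : ℕ}

/-- The probability, under the policy `π` and given `s_h = s`, of the trajectory
`s_h, s_{h+1}, …, s_H`. A trajectory is stored as a map `ω` on all times `0, …, H`, and the
coordinates before time `h`, which play no role, are pinned to `s`. -/
def MDP.trajProb (M : MDP S A H) (π : Policy S A H) (h : ℕ) (s : S) (ω : Fin (H + 1) → S) : ℝ :=
  if ∀ t : Fin (H + 1), (t : ℕ) ≤ h → ω t = s then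
    ∏ t : Fin H, if h ≤ (t : ℕ) then M.P t (ω t.castSucc) (π (ω t.castSucc) t) (ω t.succ) else 1
  else 0

/-- The V-value function `V^π_h(s) = E[∑_{t=h}^{H-1} r_t(s_t, π(s_t,t)) | π, s_h = s]`, for
`0 ≤ h ≤ H`: the expectation of the reward collected from time `h` on, over trajectories. -/
def MDP.V (M : MDP S A H) (π : Policy S A H) (h : ℕ) (s : S) : ℝ :=
  ∑ ω : Fin (H + 1) → S, M.trajProb π h s ω *
    ∑ t : Fin H, if h ≤ (t : ℕ) then M.r t (ω t.castSucc) (π (ω t.castSucc) t) else 0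

variable [Fintype A] [DecidableEq A] [Nonempty A]

/-- The optimal value `V*_h(s) = max_π V^π_h(s)`. -/
noncomputable def MDP.Vstar (M : MDP S A H) (h : ℕ) (s : S) : ℝ :=
  Finset.univ.sup' Finset.univ_nonempty fun π : Policy S A H => M.V π h s

/-- A policy is optimal if its value at time `0` is the optimal value, from every state. -/
def MDP.IsOptimal (M : MDP S A H) (π : Policy S A H) : Prop :=
  M.V π 0 = M.Vstar 0

/-- The vector `Q_{h,s}(a) = r_h(s,a) + ∑_{s'} P_h(s'|s,a) v(s')`. -/
def MDP.qvec (M : MDP S A H) (h : Fin H) (s : S) (v : S → ℝ) (a : A) : ℝ :=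
  M.r h s a + ∑ s', M.P h s a s' * v s'

end Values

/-! ### Pure states, gates and measurements -/

/-- Unitary operators on the space `ℂ^n` with orthonormal basis labelled by the finite type `n`. -/
abbrev Gate (n : Type*) [Fintype n] [DecidableEq n] := Matrix.unitaryGroup n ℂ

/-- The basis vector `|x⟩`. -/
def ket {n : Type*} [DecidableEq n] (x : n) : n → ℂ := Pi.single x 1

/-- Pure states: unit vectors of `ℂ^n`. -/
structure QState (n : Type*) [Fintype n] where
  amp : n → ℂ
  norm_eq : ∑ x, ‖amp x‖ ^ 2 = 1

section Quantum

variable {n m X Y : Type*} [Fintype n] [DecidableEq n] [Fintype m] [DecidableEq m]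
  [Fintype X] [DecidableEq X] [Fintype Y] [DecidableEq Y]

theorem sum_normSq_mulVec (U : Gate n) (ψ : n → ℂ) :
    ∑ x, ‖((U : Matrix n n ℂ).mulVec ψ) x‖ ^ 2 = ∑ x, ‖ψ x‖ ^ 2 := by
  have key : ∀ φ : n → ℂ, ((∑ x, ‖φ x‖ ^ 2 : ℝ) : ℂ) = dotProduct (star φ) φ := by
    intro φ
    simp [dotProduct, ← Complex.normSq_eq_norm_sq, Complex.normSq_eq_conj_mul_self]
  have h : ((∑ x, ‖((U : Matrix n n ℂ).mulVec ψ) x‖ ^ 2 : ℝ) : ℂ) =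
      ((∑ x, ‖ψ x‖ ^ 2 : ℝ) : ℂ) := by
    rw [key, key, Matrix.star_mulVec, Matrix.dotProduct_mulVec, Matrix.vecMul_vecMul,
      ← Matrix.star_eq_conjTranspose, Matrix.UnitaryGroup.star_mul_self, Matrix.vecMul_one]
  exact_mod_cast h

/-- The state `U |ψ⟩`. -/
def QState.apply (U : Gate n) (ψ : QState n) : QState n where
  amp := (U : Matrix n n ℂ).mulVec ψ.amp
  norm_eq := by rw [sum_normSq_mulVec, ψ.norm_eq]

/-- Measurement in the computational basis (Born rule). -/
noncomputable def QState.measure (ψ : QState n) : PMF n :=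
  PMF.ofFintype (fun x => ENNReal.ofReal (‖ψ.amp x‖ ^ 2)) (by
    rw [← ENNReal.ofReal_sum_of_nonneg (fun x _ => by positivity), ψ.norm_eq, ENNReal.ofReal_one])

/-- The gate that permutes the basis, `|x⟩ ↦ |σ x⟩`. -/
def permGate (σ : Equiv.Perm n) : Gate n :=
  ⟨Matrix.of fun i j => if i = σ j then 1 else 0, by
    rw [Matrix.mem_unitaryGroup_iff']
    ext i j
    simp [Matrix.mul_apply, Matrix.one_apply, Matrix.star_apply, eq_comm]⟩

/-- The gate that flips the sign of the basis vectors with `b x`. -/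
def phaseGate (b : n → Bool) : Gate n :=
  ⟨Matrix.diagonal fun x => if b x then -1 else 1, by
    rw [Matrix.mem_unitaryGroup_iff', Matrix.star_eq_conjTranspose, Matrix.diagonal_conjTranspose,
      Matrix.diagonal_mul_diagonal, ← Matrix.diagonal_one]
    congr 1
    ext x
    by_cases h : b x <;> simp [h]⟩

/-- The diffusion (inversion about the mean) `2|u⟩⟨u| - 1`, for the uniform superposition
`|u⟩ = N^{-1/2} ∑_x |x⟩` of the `N` basis vectors. -/
noncomputable def diffusionGate (n : Type*) [Fintype n] [DecidableEq n] [Nonempty n] : Gate n :=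
  ⟨(Matrix.of fun _ _ => (2 : ℂ) / Fintype.card n) - 1, by
    have hN : (Fintype.card n : ℂ) ≠ 0 := Nat.cast_ne_zero.2 Fintype.card_ne_zero
    have hs : star ((Matrix.of fun _ _ => (2 : ℂ) / Fintype.card n) : Matrix n n ℂ) =
        Matrix.of fun _ _ => (2 : ℂ) / Fintype.card n := by
      ext i j
      simp [Matrix.star_apply]
    have hm : ((Matrix.of fun _ _ => (2 : ℂ) / Fintype.card n) : Matrix n n ℂ) *
        (Matrix.of fun _ _ => (2 : ℂ) / Fintype.card n) =
        (2 : ℂ) • Matrix.of fun _ _ => (2 : ℂ) / Fintype.card n := by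
      ext i j
      simp [Matrix.mul_apply]
      field_simp
    rw [Matrix.mem_unitaryGroup_iff', star_sub, hs, star_one, sub_mul, mul_sub, hm, two_smul]
    simp⟩

/-- A gate acting on the registers `X` of a machine with registers `n ≃ X × Y`. -/
def liftGate (e : n ≃ X × Y) (U : Gate X) : Gate n :=
  ⟨((U : Matrix X X ℂ) ⊗ₖ (1 : Matrix Y Y ℂ)).submatrix e e, by
    have h := Matrix.kronecker_mem_unitary U.2 (one_mem (unitary (Matrix Y Y ℂ)))
    have h1 := Unitary.star_mul_self_of_mem h
    rw [Matrix.mem_unitaryGroup_iff', Matrix.star_eq_conjTranspose, Matrix.conjTranspose_submatrix,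
      Matrix.submatrix_mul_equiv, ← Matrix.star_eq_conjTranspose, h1, Matrix.submatrix_one_equiv]⟩

end Quantum

/-! ### Dürr–Høyer quantum maximum searching

The search runs over the indices `x : X`. The input is a unitary circuit `G` on `ℂ^X ⊗ ℂ^K` which,
on `|x⟩|k₀⟩`, writes the value of the list at `x` into the ancilla `K`, where `val : K → ℕ` reads
it off. The search accesses the list only through `G` and `G†`. -/

section Search

variable {X K : Type*} [Fintype X] [DecidableEq X] [Nonempty X] [Fintype K] [DecidableEq K]

/-- The state `N^{-1/2} ∑_x |x⟩|k₀⟩`. -/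
noncomputable def uniformState (X : Type*) [Fintype X] [Nonempty X] (k₀ : K) : QState (X × K) where
  amp := fun y => if y.2 = k₀ then ((1 / √(Fintype.card X) : ℝ) : ℂ) else 0
  norm_eq := by
    have hN : (Fintype.card X : ℝ) ≠ 0 := Nat.cast_ne_zero.2 Fintype.card_ne_zero
    rw [Fintype.sum_prod_type]
    have key : ∑ k : K, ‖(if k = k₀ then ((1 / √(Fintype.card X) : ℝ) : ℂ) else 0)‖ ^ 2 =
        1 / (Fintype.card X : ℝ) := by
      rw [Finset.sum_eq_single k₀]
      · rw [if_pos rfl, Complex.norm_real, Real.norm_eq_abs, sq_abs, div_pow,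
          Real.sq_sqrt (Nat.cast_nonneg _), one_pow]
      · intro k _ hk
        simp [hk]
      · simp
    refine (Finset.sum_congr rfl fun x _ => key).trans ?_
    rw [Finset.sum_const, Finset.card_univ, nsmul_eq_mul, mul_one_div_cancel hN]

/-- One Grover iteration with threshold `v`: flip the sign of the indices whose value exceeds `v`
(query `G`, compare, query `G†`), then invert about the mean. Two queries. -/
noncomputable def groverGate (G : Gate (X × K)) (val : K → ℕ) (v : ℕ) : Gate (X × K) :=
  liftGate (Equiv.refl (X × K)) (diffusionGate X) *
    (G⁻¹ * phaseGate (fun y : X × K => decide (v < val y.2)) * G)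

/-- Run `j` Grover iterations with threshold `v` on the uniform superposition, query `G` once more,
and observe the index and its value. In total `2 * j + 1` queries. -/
noncomputable def groverSample (G : Gate (X × K)) (k₀ : K) (val : K → ℕ) (v j : ℕ) :
    PMF (X × ℕ) :=
  (((uniformState X k₀).apply (G * groverGate G val v ^ j)).measure).map fun y => (y.1, val y.2)

/-- Classical memory of the search: current threshold index and its value, current bound on the
number of Grover iterations in the exponential search, and number of queries still allowed. -/
structure SearchMem (X : Type*) where
  best : X
  value : ℕ
  width : ℝ
  left : ℕ

/-- One round of the exponential search: draw `j` uniformly among the integers `0 ≤ j < width`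
and run `j` Grover iterations. If the index observed beats the threshold it becomes the new
threshold and the exponential search restarts; otherwise `width` is multiplied by `6/5`, up to
`√N`. The search is interrupted when the round does not fit into the queries still allowed. -/
noncomputable def searchRound (G : Gate (X × K)) (k₀ : K) (val : K → ℕ) (x : SearchMem X) :
    PMF (SearchMem X) :=
  (PMF.uniformOfFinset (Finset.range (max 1 ⌈x.width⌉₊)) ⟨0, by simp⟩).bind fun j =>
    if 2 * j + 1 ≤ x.left then
      (groverSample G k₀ val x.value j).map fun y =>
        if x.value < y.2 then ⟨y.1, y.2, 1, x.left - (2 * j + 1)⟩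
        else ⟨x.best, x.value, min (6 / 5 * x.width) (√(Fintype.card X)), x.left - (2 * j + 1)⟩
    else PMF.pure ⟨x.best, x.value, x.width, 0⟩

/-- One run of the Dürr–Høyer search with at most `B ≥ 1` queries: the initial threshold index is
uniformly random. Each round uses up at least one query, so `B` rounds exhaust them. The
output is the last threshold index, with its value. -/
noncomputable def searchRun (G : Gate (X × K)) (k₀ : K) (val : K → ℕ) (B : ℕ) : PMF (X × ℕ) :=
  ((fun p : PMF (SearchMem X) => p.bind (searchRound G k₀ val))^[B]
    ((groverSample G k₀ val 0 0).map fun y => ⟨y.1, y.2, 1, B - 1⟩)).map fun x => (x.best, x.value)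

/-- The best outcome of `R + 1` independent runs. -/
noncomputable def bestOfRuns (G : Gate (X × K)) (k₀ : K) (val : K → ℕ) (B : ℕ) : ℕ → PMF (X × ℕ)
  | 0 => searchRun G k₀ val B
  | R + 1 => (bestOfRuns G k₀ val B R).bind fun x =>
      (searchRun G k₀ val B).map fun y => if x.2 < y.2 then y else x

/-- `QMS_ζ`: the best of `⌈log₂(1/ζ)⌉` independent runs of the Dürr–Høyer search, of at most
`⌈c √N⌉` queries each. -/
noncomputable def qms (c : ℝ) (G : Gate (X × K)) (k₀ : K) (val : K → ℕ) (ζ : ℝ) : PMF X :=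
  (bestOfRuns G k₀ val ⌈c * √(Fintype.card X)⌉₊ (⌈Real.logb 2 (1 / ζ)⌉₊ - 1)).map Prod.fst

end Search

/-! ### Fixed-point numbers and oracles -/

/-- The contents of a register of `q` qubits. -/
abbrev Word (q : ℕ) := Fin (2 ^ q)

/-- The fixed-point binary representation of a real number `x ≥ 0` on `q` bits, `p` of which are
fractional: `⌊2^p x⌋`, exact up to `2^{-p}` when there is no overflow. -/
noncomputable def fix (p q : ℕ) (x : ℝ) : Word q :=
  Fin.ofNat (2 ^ q) ⌊(2 : ℝ) ^ p * x⌋₊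

section Oracles

variable {S A : Type*} [Fintype S] [DecidableEq S] [Fintype A] [DecidableEq A] {H p q : ℕ}

/-- `U` is a quantum oracle encoding the vector `f`: `|i⟩|0⟩ ↦ |i⟩|f(i)⟩`. -/
def IsBinaryOracle (p : ℕ) (U : Gate (S × Word q)) (f : S → ℝ) : Prop :=
  ∀ i, (U : Matrix _ _ ℂ).mulVec (ket (i, (0 : Word q))) = ket (i, fix p q (f i))

/-- Registers `|s⟩|a⟩|h⟩|s'⟩|·⟩|·⟩` of the quantum oracle of an MDP. -/
abbrev MDPReg (S A : Type*) (H q : ℕ) := S × A × Fin H × S × Word q × Word q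

/-- `O` is a quantum oracle of the MDP `M`:
`|s⟩|a⟩|h⟩|s'⟩|0⟩|0⟩ ↦ |s⟩|a⟩|h⟩|s'⟩|r_h(s,a)⟩|P_h(s'|s,a)⟩`. -/
def IsMDPOracle (p : ℕ) (M : MDP S A H) (O : Gate (MDPReg S A H q)) : Prop :=
  ∀ s a h s', (O : Matrix _ _ ℂ).mulVec (ket (s, a, h, s', (0 : Word q), (0 : Word q))) =
    ket (s, a, h, s', fix p q (M.r h s a), fix p q (M.P h s a s'))

/-! ### The circuit for the oracle encoding `Q_{h,s}` -/

/-- Ancilla registers next to the action register: `s`, `h`, `s'`, three words for the reward, the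
transition probability and the value of `s'`, and an accumulator of `2 * q` qubits. -/
structure Anc (S : Type*) (H q : ℕ) where
  s : S
  h : Fin H
  s' : S
  r : Word q
  pr : Word q
  v : Word q
  acc : Word (2 * q)

/-- The ancilla registers as a tuple. -/
def ancEquiv (S : Type*) (H q : ℕ) :
    Anc S H q ≃ (S × Fin H × S) × (Word q × Word q × Word q) × Word (2 * q) where
  toFun k := ((k.s, k.h, k.s'), (k.r, k.pr, k.v), k.acc)
  invFun k := ⟨k.1.1, k.1.2.1, k.1.2.2, k.2.1.1, k.2.1.2.1, k.2.1.2.2, k.2.2⟩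
  left_inv _ := rfl
  right_inv _ := rfl

instance : DecidableEq (Anc S H q) := (ancEquiv S H q).decidableEq

instance : Fintype (Anc S H q) := Fintype.ofEquiv _ (ancEquiv S H q).symm

/-- The registers on which the oracle of the MDP acts, and the other ones. -/
def mdpSplit : A × Anc S H q ≃ MDPReg S A H q × (Word q × Word (2 * q)) where
  toFun y := ((y.2.s, y.1, y.2.h, y.2.s', y.2.r, y.2.pr), (y.2.v, y.2.acc))
  invFun z := (z.1.2.1, ⟨z.1.1, z.1.2.2.1, z.1.2.2.2.1, z.1.2.2.2.2.1, z.1.2.2.2.2.2, z.2.1, z.2.2⟩)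
  left_inv _ := rfl
  right_inv _ := rfl

/-- The registers on which the oracle of the value vector acts, and the other ones. -/
def valueSplit : A × Anc S H q ≃
    (S × Word q) × (A × S × Fin H × Word q × Word q × Word (2 * q)) where
  toFun y := ((y.2.s', y.2.v), (y.1, y.2.s, y.2.h, y.2.r, y.2.pr, y.2.acc))
  invFun z := (z.2.1, ⟨z.2.2.1, z.2.2.2.1, z.1.1, z.2.2.2.2.1, z.2.2.2.2.2.1, z.1.2, z.2.2.2.2.2.2⟩)
  left_inv _ := rfl
  right_inv _ := rfl

/-- Exchange the contents `s` and `t` of the register `s'`. -/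
def swapGate (s t : S) : Gate (A × Anc S H q) :=
  permGate
    { toFun := fun y => (y.1, { y.2 with s' := Equiv.swap s t y.2.s' })
      invFun := fun y => (y.1, { y.2 with s' := Equiv.swap s t y.2.s' })
      left_inv := fun y => by simp
      right_inv := fun y => by simp }

/-- Multiply-and-add: add the product of the probability and value words to the accumulator (whose
unit is `2^{-2p}`). -/
def mulAddGate : Gate (A × Anc S H q) :=
  permGate
    { toFun := fun y => (y.1, { y.2 with
        acc := y.2.acc + Fin.ofNat (2 ^ (2 * q)) (y.2.pr.val * y.2.v.val) })
      invFun := fun y => (y.1, { y.2 with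
        acc := y.2.acc - Fin.ofNat (2 ^ (2 * q)) (y.2.pr.val * y.2.v.val) })
      left_inv := fun y => by simp
      right_inv := fun y => by simp }

/-- Add the reward word, shifted by `p` bits to the unit `2^{-2p}`, to the accumulator. -/
def addRewardGate (p : ℕ) : Gate (A × Anc S H q) :=
  permGate
    { toFun := fun y => (y.1, { y.2 with
        acc := y.2.acc + Fin.ofNat (2 ^ (2 * q)) (2 ^ p * y.2.r.val) })
      invFun := fun y => (y.1, { y.2 with
        acc := y.2.acc - Fin.ofNat (2 ^ (2 * q)) (2 ^ p * y.2.r.val) })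
      left_inv := fun y => by simp
      right_inv := fun y => by simp }

/-- For one next state `t`: load `t` into the register `s'`, query the oracles of the MDP and of the
value vector, multiply and add, and undo everything but the addition. -/
def addTermGate (O : Gate (MDPReg S A H q)) (UV : Gate (S × Word q)) (s t : S) :
    Gate (A × Anc S H q) :=
  (swapGate s t)⁻¹ * (liftGate mdpSplit O)⁻¹ * (liftGate valueSplit UV)⁻¹ * mulAddGate *
    liftGate valueSplit UV * liftGate mdpSplit O * swapGate s t

/-- The circuit that encodes `Q_{h,s}`. On `|a⟩` and ancillas `|s⟩|h⟩|s⟩|0⟩|0⟩|0⟩|0⟩`, it leaves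
`r_h(s,a) + ∑_{s'} P_h(s'|s,a) v(s')`, computed in fixed-point arithmetic, in the accumulator and
restores the other registers. It makes `2 |S| + 2` queries to `O` and `O†`. -/
noncomputable def qOracle (p : ℕ) (O : Gate (MDPReg S A H q)) (UV : Gate (S × Word q)) (s : S) :
    Gate (A × Anc S H q) :=
  (liftGate mdpSplit O)⁻¹ * addRewardGate p * liftGate mdpSplit O *
    ((Finset.univ : Finset S).toList.map fun t => addTermGate O UV s t).prod

end Oracles

/-! ### Quantum value iteration -/

/-- Independent sampling: the product of finitely many distributions on a finite type. -/
noncomputable def indep {S A : Type*} [Fintype S] [DecidableEq S] [Fintype A]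
    (μ : S → PMF A) : PMF (S → A) :=
  PMF.ofFintype (fun f => ∏ s, μ s (f s)) (by
    have h : ∀ s, ∑ a, μ s a = 1 := fun s => by
      rw [← tsum_fintype (L := .unconditional A)]
      exact (μ s).tsum_coe
    rw [← Fintype.prod_sum]
    simp [h])

section Algorithm

variable {S A : Type*} [Fintype S] [DecidableEq S] [Fintype A] [DecidableEq A] [Nonempty A]
  {H q : ℕ}

/-- One iteration, at time `h`, of quantum value iteration. The current policy and the current value
vector `V_{h+1}` are the two components of `x`. For every state `s`, `QMS` with failure probability
`δ / (|S| H)` is run on the oracle that encodes `Q_{h,s}` and selects the action `a s`. Then the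
policy at time `h` is set to `a`, and `V_h(s)` is set to `Q_{h,s}(a s)`. -/
noncomputable def qviStep (c : ℝ) (p : ℕ) (M : MDP S A H) (O : Gate (MDPReg S A H q))
    (UV : (S → ℝ) → Gate (S × Word q)) (δ : ℝ) (h : Fin H) (x : Policy S A H × (S → ℝ)) :
    PMF (Policy S A H × (S → ℝ)) :=
  (indep fun s => qms c (qOracle p O (UV x.2) s) (⟨s, h, s, 0, 0, 0, 0⟩ : Anc S H q)
      (fun k => k.acc.val) (δ / (Fintype.card S * H))).map fun a =>
    (fun s t => if t = h then a s else x.1 s t, fun s => M.qvec h s x.2 (a s))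

/-- The algorithm `QVI-1`: start with `V_H = 0` (and an arbitrary policy, all of whose entries are
going to be overwritten), iterate over `h = H - 1, …, 0`, and return the policy and `V_0`. -/
noncomputable def qvi1 (c : ℝ) (p : ℕ) (M : MDP S A H) (O : Gate (MDPReg S A H q))
    (UV : (S → ℝ) → Gate (S × Word q)) (δ : ℝ) : PMF (Policy S A H × (S → ℝ)) :=
  (List.finRange H).foldr (fun h μ => μ.bind (qviStep c p M O UV δ h))
    (PMF.pure (fun _ _ => Classical.arbitrary A, 0))

end Algorithm

end QVI

/-!
Quantum value iteration is backward induction in which every maximization over actions is done by a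
randomized quantum search, so correctness has three ingredients: a bound for the failure probability
of one search, an exact description of the circuit that is searched, and dynamic programming.

**The search.** A circuit that writes the value of `x` next to `|x⟩` keeps the Grover iteration in
the plane spanned by the uniform superpositions of the marked and of the unmarked indices, where it
is a rotation by `2θ` with `sin² θ = t / N` (`groverAmp_eq`). Hence a run with a uniformly random
number `j < m` of iterations observes a marked index with probability at least `1/4` as soon as
`m ≥ √(N/t)` (`quarter_le_sum_sin_sq`), for every `0 < t < N`: beyond `θ = π/4` one argues with the
complementary angle. In terms of the potential

  `Φ = stageCost (√(N/t)) w + 72 √N (1 - 1/√t)`,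

where `t` is the number of indices beating the threshold and `w` the current width, a round lowers
the expected potential by at least the expected number of its queries (`searchPotential_round`).
Here the first summand pays for the exponential search at the current threshold, and the second
one for all later thresholds: the next threshold is uniform among the `t` candidates, so the sum
over its possible ranks is controlled by `∑_{1≤i<t} (2 - 1/√i) ≤ 2t - 2√t`, and equal values only
lower the ranks (`sum_rankCost_le`). As the potential is at most `72 √N` at the beginning,
Markov's inequality, in the form of an induction that keeps track of the remaining budget
(`failProb_searchRound_iterate`), shows that `146 √N` queries suffice for failure probability
`1/2`; repetition gives `ζ` (`failProb_qms`).

**The circuit.** On the inputs that occur, every gate of `qOracle` maps basis vectors to basis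
vectors, so its action can be followed vector by vector (`mapsKet_qOracle`). The accumulator ends
up with `qFixed`, which is `Q` rounded down with an error of order `2^{-p}`. For large `p` this is
below the smallest positive gap between values of the optimal `Q` (`MDP.exists_precision`), so a
maximizer of the rounded vector is a maximizer of the exact one.

**Dynamic programming.** Decomposing trajectories after the first step gives the Bellman equation
(`MDP.V_step`), and a policy that is optimal from time `h + 1` on and greedy at time `h` is optimal
from time `h` on (`MDP.V_eq_Vstar_of_greedy`). A union bound over the states and the times finishes
the proof; it only needs the search to be reliable when the preceding value vector is the optimal
one, so that all numbers stay in `[0, H]`.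
-/

namespace QVI

/-! ### Expectations of discrete distributions -/

section Expectation

open scoped ENNReal

variable {α β : Type*}

/-- The expectation of a `[0, ∞]`-valued function under a discrete distribution. -/
noncomputable def expect (p : PMF α) (f : α → ℝ≥0∞) : ℝ≥0∞ := ∑' a, p a * f a

theorem expect_pure (a : α) (f : α → ℝ≥0∞) : expect (PMF.pure a) f = f a := by
  rw [expect, tsum_eq_single a]
  · simp
  · intro b hb
    simp [PMF.pure_apply, hb]

theorem expect_bind (p : PMF α) (k : α → PMF β) (f : β → ℝ≥0∞) :
    expect (p.bind k) f = expect p fun a => expect (k a) f := by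
  simp only [expect, PMF.bind_apply, ← ENNReal.tsum_mul_right, ← ENNReal.tsum_mul_left]
  rw [ENNReal.tsum_comm]
  simp only [mul_assoc]

theorem expect_map (g : α → β) (p : PMF α) (f : β → ℝ≥0∞) :
    expect (p.map g) f = expect p fun a => f (g a) := by
  rw [PMF.map, expect_bind]
  simp [expect_pure]

theorem expect_mono {p : PMF α} {f g : α → ℝ≥0∞} (h : ∀ a ∈ p.support, f a ≤ g a) :
    expect p f ≤ expect p g := by
  refine ENNReal.tsum_le_tsum fun a => ?_
  by_cases ha : p a = 0
  · simp [ha]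
  · gcongr
    exact h a ha

theorem expect_const (p : PMF α) (c : ℝ≥0∞) : expect p (fun _ => c) = c := by
  rw [expect, ENNReal.tsum_mul_right, p.tsum_coe, one_mul]

theorem expect_le_of_forall {p : PMF α} {f : α → ℝ≥0∞} {c : ℝ≥0∞}
    (h : ∀ a ∈ p.support, f a ≤ c) : expect p f ≤ c :=
  (expect_mono h).trans_eq (expect_const p c)

theorem expect_mul_left (p : PMF α) (c : ℝ≥0∞) (f : α → ℝ≥0∞) :
    expect p (fun a => c * f a) = c * expect p f := by
  simp only [expect, ← ENNReal.tsum_mul_left]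
  exact tsum_congr fun a => mul_left_comm _ _ _

theorem expect_add (p : PMF α) (f g : α → ℝ≥0∞) :
    expect p (fun a => f a + g a) = expect p f + expect p g := by
  simp only [expect, mul_add, ENNReal.tsum_add]

theorem expect_sum [Fintype β] (p : PMF α) (f : β → α → ℝ≥0∞) :
    expect p (fun a => ∑ b, f b a) = ∑ b, expect p (f b) := by
  simp only [expect, Finset.mul_sum]
  exact Summable.tsum_finsetSum fun _ _ => ENNReal.summable

theorem expect_uniformOfFinset (s : Finset α) (hs : s.Nonempty) (f : α → ℝ≥0∞) :
    expect (PMF.uniformOfFinset s hs) f = ∑ a ∈ s, (s.card : ℝ≥0∞)⁻¹ * f a := by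
  rw [expect, tsum_eq_sum (s := s)]
  · exact Finset.sum_congr rfl fun a ha => by rw [PMF.uniformOfFinset_apply_of_mem hs ha]
  · intro a ha
    rw [PMF.uniformOfFinset_apply_of_notMem hs ha, zero_mul]

theorem expect_ofFintype [Fintype α] (p : α → ℝ≥0∞) (hp : ∑ a, p a = 1) (f : α → ℝ≥0∞) :
    expect (PMF.ofFintype p hp) f = ∑ a, p a * f a := by
  simp [expect, tsum_fintype]

open Classical in
/-- The probability that a predicate fails. -/
noncomputable def failProb (p : PMF α) (good : α → Prop) : ℝ≥0∞ :=
  expect p fun a => if good a then 0 else 1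

theorem one_sub_failProb_le (p : PMF α) (good : α → Prop) :
    1 - failProb p good ≤ p.toOuterMeasure {a | good a} := by
  classical
  rw [tsub_le_iff_right, PMF.toOuterMeasure_apply, failProb, expect, ← ENNReal.tsum_add,
    ← p.tsum_coe]
  refine ENNReal.tsum_le_tsum fun a => ?_
  by_cases h : good a <;> simp [h]

theorem failProb_le_one (p : PMF α) (good : α → Prop) : failProb p good ≤ 1 := by
  classical
  refine expect_le_of_forall fun a _ => ?_
  split_ifs <;> simp

theorem failProb_map (g : α → β) (p : PMF α) (good : β → Prop) :
    failProb (p.map g) good = failProb p fun a => good (g a) :=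
  expect_map _ _ _

theorem failProb_bind (p : PMF α) (k : α → PMF β) (good : β → Prop) :
    failProb (p.bind k) good = expect p fun a => failProb (k a) good :=
  expect_bind _ _ _

/-- Monotonicity of the failure probability, on the support. -/
theorem failProb_mono {p : PMF α} {good good' : α → Prop} (h : ∀ a ∈ p.support, good a → good' a) :
    failProb p good' ≤ failProb p good := by
  classical
  refine expect_mono fun a ha => ?_
  have := h a ha
  split_ifs <;> simp_all

theorem failProb_eq_zero {p : PMF α} {good : α → Prop} (h : ∀ a ∈ p.support, good a) :
    failProb p good = 0 := by
  classical
  exact nonpos_iff_eq_zero.1 (expect_le_of_forall fun a ha => by simp [h a ha])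

/-- Union bound over two successive steps of a randomized computation. -/
theorem failProb_bind_le {p : PMF α} {k : α → PMF β} {good : α → Prop} {good' : β → Prop}
    {ε : ℝ≥0∞} (h : ∀ a, good a → failProb (k a) good' ≤ ε) :
    failProb (p.bind k) good' ≤ failProb p good + ε := by
  classical
  rw [failProb_bind, failProb, ← expect_const p ε, ← expect_add]
  refine expect_mono fun a _ => ?_
  by_cases ha : good a
  · simpa [ha] using h a ha
  · simpa [ha] using (failProb_le_one _ _).trans le_self_add

theorem expect_indep {S A : Type*} [Fintype S] [DecidableEq S] [Fintype A] (μ : S → PMF A) (s : S)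
    (F : A → ℝ≥0∞) : expect (indep μ) (fun f => F (f s)) = expect (μ s) F := by
  have hone : ∀ t, ∑ a, μ t a = 1 := fun t => by
    rw [← tsum_fintype (L := .unconditional A)]
    exact (μ t).tsum_coe
  have h := Fintype.prod_sum fun (t : S) (a : A) => μ t a * if t = s then F a else 1
  rw [indep, expect_ofFintype, expect, tsum_fintype]
  calc ∑ f : S → A, (∏ t, μ t (f t)) * F (f s)
      = ∑ f : S → A, ∏ t, (μ t (f t) * if t = s then F (f t) else 1) := by
        refine Finset.sum_congr rfl fun f _ => ?_
        rw [Finset.prod_mul_distrib]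
        simp
    _ = ∏ t, ∑ a, (μ t a * if t = s then F a else 1) := h.symm
    _ = ∑ a, μ s a * F a := by
        rw [Finset.prod_eq_single s]
        · simp
        · intro t _ ht
          simp [ht, hone]
        · simp

/-- Union bound for independent samples. -/
theorem failProb_indep_le {S A : Type*} [Fintype S] [DecidableEq S] [Fintype A] (μ : S → PMF A)
    (good : S → A → Prop) :
    failProb (indep μ) (fun f => ∀ s, good s (f s)) ≤ ∑ s, failProb (μ s) (good s) := by
  classical
  simp only [failProb]
  rw [← Finset.sum_congr rfl fun s _ =>
    expect_indep μ s fun a => if good s a then (0 : ℝ≥0∞) else 1, ← expect_sum]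
  refine expect_mono fun f _ => ?_
  split_ifs with h
  · simp
  · push Not at h
    obtain ⟨s, hs⟩ := h
    refine le_trans (by simp [hs]) (Finset.single_le_sum (fun _ _ => zero_le) (Finset.mem_univ s))

end Expectation

/-! ### Grover iterations -/

section Grover

open scoped ENNReal

section Amplitudes

variable {X : Type*} [Fintype X]

/-- The sign `-1` of the marked indices. -/
def oracleSign (b : X → Bool) (x : X) : ℝ := if b x then -1 else 1

/-- The effect of a Grover iteration on real amplitudes: flip the sign of the marked ones, then
invert about the mean. -/
noncomputable def groverStep (b : X → Bool) (a : X → ℝ) (x : X) : ℝ :=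
  2 / Fintype.card X * ∑ z, oracleSign b z * a z - oracleSign b x * a x

/-- The amplitudes after `j` Grover iterations on the uniform superposition. -/
noncomputable def groverAmp (b : X → Bool) (j : ℕ) : X → ℝ :=
  (groverStep b)^[j] fun _ => 1 / √(Fintype.card X)

/-- The closed form of the amplitudes: with `t` marked indices out of `N` and `sin² θ = t / N`, the
state after `j` iterations has the angle `(2 j + 1) θ` with the span of the unmarked ones. -/
theorem groverAmp_eq [Nonempty X] (b : X → Bool) (t u : ℕ)
    (ht : (Finset.univ.filter fun x => b x = true).card = t)
    (hu : (Finset.univ.filter fun x => ¬ b x = true).card = u) (ht0 : 0 < t) (hu0 : 0 < u) (θ : ℝ)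
    (hs : Real.sin θ = √t / √(Fintype.card X)) (hc : Real.cos θ = √u / √(Fintype.card X)) (j : ℕ) :
    groverAmp b j = fun x => if b x then Real.sin ((2 * j + 1) * θ) / √t
      else Real.cos ((2 * j + 1) * θ) / √u := by
  have hN : (t : ℝ) + u = Fintype.card X := by
    rw [← ht, ← hu]
    exact_mod_cast Finset.card_filter_add_card_filter_not _
  have htp : (0 : ℝ) < t := Nat.cast_pos.2 ht0
  have hup : (0 : ℝ) < u := Nat.cast_pos.2 hu0
  have hst : 0 < √(t : ℝ) := Real.sqrt_pos.2 htp
  have hsu : 0 < √(u : ℝ) := Real.sqrt_pos.2 hup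
  have hsN : 0 < √(Fintype.card X : ℝ) := Real.sqrt_pos.2 (by linarith)
  have htt : √(t : ℝ) ^ 2 = t := Real.sq_sqrt htp.le
  have huu : √(u : ℝ) ^ 2 = u := Real.sq_sqrt hup.le
  have hNN : √(Fintype.card X : ℝ) ^ 2 = Fintype.card X := Real.sq_sqrt (by linarith)
  have hNtu : √(Fintype.card X : ℝ) ^ 2 = √(t : ℝ) ^ 2 + √(u : ℝ) ^ 2 := by
    rw [hNN, htt, huu, hN]
  induction j with
  | zero =>
    ext x
    simp only [groverAmp, Function.iterate_zero, id, Nat.cast_zero, mul_zero, zero_add, one_mul, hs,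
      hc]
    split_ifs <;> field_simp
  | succ j ih =>
    rw [groverAmp, Function.iterate_succ_apply', ← groverAmp, ih]
    set φ : ℝ := (2 * j + 1) * θ with hφ
    have hang : (2 * ((j + 1 : ℕ) : ℝ) + 1) * θ = φ + 2 * θ := by
      rw [hφ]
      push_cast
      ring
    have hsum : ∑ z, oracleSign b z *
        (if b z then Real.sin φ / √t else Real.cos φ / √u) =
        √u * Real.cos φ - √t * Real.sin φ := by
      have h1 : ∀ z, oracleSign b z * (if b z then Real.sin φ / √t else Real.cos φ / √u) =
          if b z then -(Real.sin φ / √t) else Real.cos φ / √u := by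
        intro z
        by_cases hz : b z <;> simp [oracleSign, hz]
      rw [Finset.sum_congr rfl fun z _ => h1 z, Finset.sum_ite, Finset.sum_const, Finset.sum_const,
        ht, hu, nsmul_eq_mul, nsmul_eq_mul]
      linear_combination Real.cos φ * Real.div_sqrt (x := (u : ℝ)) -
        Real.sin φ * Real.div_sqrt (x := (t : ℝ))
    ext x
    rw [groverStep, hsum, hang, Real.sin_add, Real.cos_add, Real.sin_two_mul, Real.cos_two_mul, hs,
      hc]
    have hD : √(t : ℝ) ^ 2 + √(u : ℝ) ^ 2 ≠ 0 := by positivity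
    have hsq : √(Fintype.card X : ℝ) * √(Fintype.card X : ℝ) = √(t : ℝ) ^ 2 + √(u : ℝ) ^ 2 := by
      rw [← hNtu, sq]
    have e1 : 2 * (√(t : ℝ) / √(Fintype.card X : ℝ)) * (√(u : ℝ) / √(Fintype.card X : ℝ)) =
        2 * √(t : ℝ) * √(u : ℝ) / (√(t : ℝ) ^ 2 + √(u : ℝ) ^ 2) := by
      rw [← hsq]
      field_simp
    have e2 : 2 * (√(u : ℝ) / √(Fintype.card X : ℝ)) ^ 2 - 1 =
        (√(u : ℝ) ^ 2 - √(t : ℝ) ^ 2) / (√(t : ℝ) ^ 2 + √(u : ℝ) ^ 2) := by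
      rw [div_pow, hNtu]
      field_simp
      ring
    rw [e1, e2, ← hNN, hNtu]
    by_cases hx : b x
    · simp only [oracleSign, hx, if_true]
      field_simp
      ring
    · simp only [oracleSign, hx]
      field_simp
      simp only [Bool.false_eq_true, if_false]
      field_simp
      ring

theorem sum_sin_sq_odd (θ : ℝ) (m : ℕ) :
    4 * Real.sin (2 * θ) * ∑ j ∈ Finset.range m, Real.sin ((2 * j + 1) * θ) ^ 2 =
      2 * m * Real.sin (2 * θ) - Real.sin (4 * m * θ) := by
  induction m with
  | zero => simp
  | succ m ih =>
    rw [Finset.sum_range_succ, mul_add, ih]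
    have h1 : Real.sin (4 * ((m + 1 : ℕ) : ℝ) * θ) =
        Real.sin (2 * ((2 * m + 1) * θ) + 2 * θ) := by
      congr 1
      push_cast
      ring
    have h2 : Real.sin (4 * (m : ℝ) * θ) = Real.sin (2 * ((2 * m + 1) * θ) - 2 * θ) := by
      congr 1
      ring
    rw [h1, h2, Real.sin_add, Real.sin_sub, Real.cos_two_mul ((2 * (m : ℝ) + 1) * θ), Real.cos_sq']
    push_cast
    ring

/-- With a uniformly random number `j < m` of iterations, a marked index is observed with
probability at least `1/4` as soon as `m ≥ 1 / sin θ`: the average over `j` is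
`1/2 - sin (4mθ) / (4m sin 2θ)`. -/
theorem quarter_le_sum_sin_sq {θ : ℝ} (h0 : 0 < θ) (h1 : θ < Real.pi / 2) {m : ℕ}
    (hm : 1 ≤ m * Real.sin θ) :
    (m : ℝ) / 4 ≤ ∑ j ∈ Finset.range m, Real.sin ((2 * j + 1) * θ) ^ 2 := by
  have hs2 : 0 < Real.sin (2 * θ) := Real.sin_pos_of_pos_of_lt_pi (by linarith) (by linarith)
  have key := sum_sin_sq_odd θ m
  suffices h : Real.sin (4 * m * θ) ≤ m * Real.sin (2 * θ) by
    have : Real.sin (2 * θ) * (m / 4) ≤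
        Real.sin (2 * θ) * ∑ j ∈ Finset.range m, Real.sin ((2 * j + 1) * θ) ^ 2 := by
      nlinarith
    exact le_of_mul_le_mul_left this hs2
  have hs : 0 < Real.sin θ := Real.sin_pos_of_pos_of_lt_pi h0 (by linarith)
  rcases le_or_gt θ (Real.pi / 4) with hq | hq
  · -- here `sin 2θ ≥ sin θ`, because `cos θ ≥ 1/2`
    have hcos : 1 / 2 ≤ Real.cos θ := by
      rw [← Real.cos_pi_div_three]
      exact Real.cos_le_cos_of_nonneg_of_le_pi h0.le (by linarith [Real.pi_pos])
        (by linarith [Real.pi_pos])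
    have : Real.sin θ ≤ Real.sin (2 * θ) := by
      rw [Real.sin_two_mul]
      nlinarith
    calc Real.sin (4 * m * θ) ≤ 1 := Real.sin_le_one _
      _ ≤ m * Real.sin θ := hm
      _ ≤ m * Real.sin (2 * θ) := by gcongr
  · -- pass to the complementary angle `η`; a positive left-hand side forces `4 m η ≥ π`
    obtain ⟨η, rfl⟩ : ∃ η, θ = Real.pi / 2 - η := ⟨Real.pi / 2 - θ, by ring⟩
    have e1 : Real.sin (2 * (Real.pi / 2 - η)) = Real.sin (2 * η) := by
      rw [← Real.sin_pi_sub (2 * η)]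
      congr 1
      ring
    have e2 : Real.sin (4 * m * (Real.pi / 2 - η)) = -Real.sin (4 * m * η) := by
      rw [← Real.sin_neg, ← Real.sin_add_nat_mul_two_pi (-(4 * m * η)) m]
      congr 1
      ring
    rw [e1, e2]
    have hη : 0 ≤ η := by linarith
    have hm0 : (0 : ℝ) ≤ m := Nat.cast_nonneg m
    have hj := Real.mul_le_sin (x := 2 * η) (by linarith) (by linarith)
    have hs2η : 0 ≤ Real.sin (2 * η) := le_trans (by positivity) hj
    rcases le_or_gt (4 * m * η) Real.pi with h4 | h4
    · have := Real.sin_nonneg_of_nonneg_of_le_pi (by positivity : 0 ≤ 4 * m * η) h4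
      have : 0 ≤ m * Real.sin (2 * η) := by positivity
      linarith
    · have h5 : 1 ≤ m * (2 / Real.pi * (2 * η)) := by
        rw [show (m : ℝ) * (2 / Real.pi * (2 * η)) = 4 * m * η / Real.pi by ring,
          one_le_div Real.pi_pos]
        exact h4.le
      have h6 : (m : ℝ) * (2 / Real.pi * (2 * η)) ≤ m * Real.sin (2 * η) := by gcongr
      linarith [Real.neg_one_le_sin (4 * m * η)]

end Amplitudes

variable {X K : Type*} [Fintype X] [Fintype K] [DecidableEq K]

/-- The vector `∑_x a(x) |x⟩|κ(x)⟩`. -/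
def graphState (κ : X → K) (a : X → ℝ) : X × K → ℂ :=
  fun y => if y.2 = κ y.1 then (a y.1 : ℂ) else 0

theorem sum_graphState (κ : X → K) (a : X → ℝ) (g : X × K → ℂ) :
    ∑ y, g y * graphState κ a y = ∑ x, g (x, κ x) * a x := by
  rw [Fintype.sum_prod_type]
  refine Finset.sum_congr rfl fun x _ => ?_
  simp [graphState]

variable [DecidableEq X]

theorem mulVec_ket {n : Type*} [Fintype n] [DecidableEq n] (U : Matrix n n ℂ) (x y : n) :
    U.mulVec (ket x) y = U y x := by
  simp [ket]

/-- A gate writing `κ(x)` next to `|x⟩` acts on superpositions by linearity. -/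
theorem mulVec_graphState {G : Gate (X × K)} {k₀ : K} {κ : X → K}
    (hG : ∀ x, (G : Matrix _ _ ℂ).mulVec (ket (x, k₀)) = ket (x, κ x)) (a : X → ℝ) :
    (G : Matrix _ _ ℂ).mulVec (graphState (fun _ => k₀) a) = graphState κ a := by
  ext y
  have h : ∀ x, (G : Matrix _ _ ℂ) y (x, k₀) = if y = (x, κ x) then 1 else 0 := by
    intro x
    refine (mulVec_ket _ _ _).symm.trans ?_
    rw [hG, ket, Pi.single_apply]
  simp only [Matrix.mulVec, dotProduct, sum_graphState, h]
  obtain ⟨x, k⟩ := y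
  by_cases hk : k = κ x
  · simp only [graphState, hk, if_true, ite_mul, one_mul, zero_mul]
    rw [Finset.sum_eq_single x]
    · simp
    · intro z _ hz
      simp [hz.symm]
    · simp
  · simp only [graphState, hk, if_false]
    refine Finset.sum_eq_zero fun z _ => ?_
    rw [if_neg, zero_mul]
    rintro h
    obtain ⟨rfl, rfl⟩ := Prod.mk.inj h
    exact hk rfl

theorem gate_inv_mulVec {n : Type*} [Fintype n] [DecidableEq n] {U : Gate n} {φ ψ : n → ℂ}
    (h : (U : Matrix n n ℂ).mulVec φ = ψ) : ((U⁻¹ : Gate n) : Matrix n n ℂ).mulVec ψ = φ := by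
  rw [← h, Matrix.mulVec_mulVec, ← Submonoid.coe_mul, inv_mul_cancel, Submonoid.coe_one,
    Matrix.one_mulVec]

theorem gate_mul_mulVec {n : Type*} [Fintype n] [DecidableEq n] (U V : Gate n) (φ : n → ℂ) :
    ((U * V : Gate n) : Matrix n n ℂ).mulVec φ =
      (U : Matrix n n ℂ).mulVec ((V : Matrix n n ℂ).mulVec φ) := by
  rw [Matrix.mulVec_mulVec, Submonoid.coe_mul]

theorem phaseGate_mulVec_graphState (b : X × K → Bool) (κ : X → K) (a : X → ℝ) :
    (phaseGate b : Matrix _ _ ℂ).mulVec (graphState κ a) =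
      graphState κ fun x => oracleSign (fun x => b (x, κ x)) x * a x := by
  ext ⟨x, k⟩
  simp only [phaseGate, Matrix.mulVec_diagonal, graphState, oracleSign]
  by_cases hk : k = κ x
  · subst hk
    by_cases hb : b (x, κ x) <;> simp [hb]
  · simp [hk]

theorem diffusionGate_mulVec_graphState [Nonempty X] (k₀ : K) (a : X → ℝ) :
    (liftGate (Equiv.refl (X × K)) (diffusionGate X) : Matrix _ _ ℂ).mulVec
        (graphState (fun _ => k₀) a) =
      graphState (fun _ => k₀) fun x => 2 / Fintype.card X * ∑ z, a z - a x := by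
  ext ⟨x, k⟩
  simp only [Matrix.mulVec, dotProduct, sum_graphState]
  simp only [liftGate, diffusionGate, Matrix.submatrix_apply, Equiv.refl_apply,
    Matrix.kroneckerMap_apply, Matrix.sub_apply, Matrix.of_apply, Matrix.one_apply, graphState]
  by_cases hk : k = k₀
  · simp [hk, sub_mul, Finset.mul_sum]
  · simp [hk]

variable [Nonempty X]

theorem groverGate_mulVec_graphState {G : Gate (X × K)} {k₀ : K} {κ : X → K}
    (hG : ∀ x, (G : Matrix _ _ ℂ).mulVec (ket (x, k₀)) = ket (x, κ x)) (val : K → ℕ) (v : ℕ)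
    (a : X → ℝ) :
    (groverGate G val v : Matrix _ _ ℂ).mulVec (graphState (fun _ => k₀) a) =
      graphState (fun _ => k₀) (groverStep (fun x => decide (v < val (κ x))) a) := by
  rw [groverGate, gate_mul_mulVec, gate_mul_mulVec, gate_mul_mulVec, mulVec_graphState hG,
    phaseGate_mulVec_graphState, gate_inv_mulVec (mulVec_graphState hG _),
    diffusionGate_mulVec_graphState]
  rfl

theorem groverGate_pow_mulVec {G : Gate (X × K)} {k₀ : K} {κ : X → K}
    (hG : ∀ x, (G : Matrix _ _ ℂ).mulVec (ket (x, k₀)) = ket (x, κ x)) (val : K → ℕ) (v j : ℕ) :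
    ((groverGate G val v ^ j : Gate (X × K)) : Matrix _ _ ℂ).mulVec (uniformState X k₀).amp =
      graphState (fun _ => k₀) (groverAmp (fun x => decide (v < val (κ x))) j) := by
  induction j with
  | zero =>
    rw [pow_zero, Submonoid.coe_one, Matrix.one_mulVec]
    rfl
  | succ j ih =>
    rw [pow_succ', gate_mul_mulVec, ih, groverGate_mulVec_graphState hG, groverAmp, groverAmp,
      Function.iterate_succ_apply']

/-- The outcome of a Grover run is `(x, val (κ x))` with probability the squared amplitude. -/
theorem expect_groverSample {G : Gate (X × K)} {k₀ : K} {κ : X → K}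
    (hG : ∀ x, (G : Matrix _ _ ℂ).mulVec (ket (x, k₀)) = ket (x, κ x)) (val : K → ℕ) (v j : ℕ)
    (f : X × ℕ → ℝ≥0∞) :
    expect (groverSample G k₀ val v j) f =
      ∑ x, ENNReal.ofReal (groverAmp (fun x => decide (v < val (κ x))) j x ^ 2) *
        f (x, val (κ x)) := by
  rw [groverSample, expect_map, QState.measure, expect_ofFintype]
  simp only [QState.apply, gate_mul_mulVec, groverGate_pow_mulVec hG, mulVec_graphState hG]
  rw [Fintype.sum_prod_type]
  refine Finset.sum_congr rfl fun x _ => ?_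
  rw [Finset.sum_eq_single (κ x)]
  · simp [graphState]
  · intro k _ hk
    simp [graphState, hk]
  · simp

theorem support_groverSample {G : Gate (X × K)} {k₀ : K} {κ : X → K}
    (hG : ∀ x, (G : Matrix _ _ ℂ).mulVec (ket (x, k₀)) = ket (x, κ x)) (val : K → ℕ) (v j : ℕ)
    {y : X × ℕ} (hy : y ∈ (groverSample G k₀ val v j).support) : y.2 = val (κ y.1) := by
  by_contra hne
  have h := expect_groverSample hG val v j fun z => if z = y then 1 else 0
  rw [expect, tsum_eq_single y (fun z hz => by simp [hz]), Finset.sum_eq_zero] at h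
  · rw [if_pos rfl, mul_one] at h
    exact (PMF.mem_support_iff _ _).1 hy h
  · intro x _
    rw [if_neg, mul_zero]
    rintro rfl
    exact hne rfl

end Grover

/-! ### The potential of the Dürr–Høyer search -/

section Potential

/-- Bound for the expected number of queries until the exponential search with current width `w`
observes a marked index, where `τ = √(N / t)` for `t` marked indices out of `N`. A round costs at
most `2 w` queries on average. Below `τ`, where nothing is known about its success, this is the
decrease of `-10 w` as `w` grows by the factor `6/5`; from `τ` on a round fails with probability
at most `3/4`, and `2 w + 3/4 * 20 * (6/5 * w) = 20 w`. -/
noncomputable def stageCost (τ w : ℝ) : ℝ := if w < τ then 36 * τ - 10 * w else 20 * w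

theorem stageCost_nonneg {τ w : ℝ} (hw : 0 ≤ w) : 0 ≤ stageCost τ w := by
  unfold stageCost
  split_ifs <;> linarith

theorem stageCost_one_le {τ : ℝ} (hτ : 1 ≤ τ) : stageCost τ 1 ≤ 36 * τ := by
  unfold stageCost
  split_ifs <;> linarith

/-- One round of width `w`, with `m = ⌈w⌉` queries on average and success probability `P`, is paid
for by the decrease of the stage cost. -/
theorem add_stageCost_le {τ s w m P : ℝ} (hτs : τ ≤ s) (hw : 1 ≤ w) (hs : 1 ≤ s) (hwm : w ≤ m)
    (hm : m ≤ w + 1) (hP : 0 ≤ P) (hP4 : τ ≤ m → 1 / 4 ≤ P) :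
    m + (1 - P) * stageCost τ (min (6 / 5 * w) s) ≤ stageCost τ w := by
  have hmin : 1 ≤ min (6 / 5 * w) s := le_min (by linarith) hs
  have hn : 0 ≤ stageCost τ (min (6 / 5 * w) s) := stageCost_nonneg (by linarith)
  have hmw : min (6 / 5 * w) s ≤ 6 / 5 * w := min_le_left _ _
  rcases lt_or_ge w τ with h | h
  · have h1 : (1 - P) * stageCost τ (min (6 / 5 * w) s) ≤ stageCost τ (min (6 / 5 * w) s) := by
      nlinarith
    have h2 : stageCost τ w = 36 * τ - 10 * w := if_pos h
    rcases lt_or_ge (min (6 / 5 * w) s) τ with h' | h'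
    · have h3 : min (6 / 5 * w) s = 6 / 5 * w := by
        rcases min_choice (6 / 5 * w) s with e | e
        · exact e
        · rw [e] at h'
          linarith
      have h4 : stageCost τ (min (6 / 5 * w) s) = 36 * τ - 10 * (6 / 5 * w) := by
        rw [stageCost, if_pos h', h3]
      linarith
    · have h4 : stageCost τ (min (6 / 5 * w) s) = 20 * min (6 / 5 * w) s := if_neg h'.not_gt
      linarith
  · have h2 : stageCost τ w = 20 * w := if_neg h.not_gt
    have h' : τ ≤ min (6 / 5 * w) s := le_min (by linarith) hτs
    have h4 : stageCost τ (min (6 / 5 * w) s) = 20 * min (6 / 5 * w) s := if_neg h'.not_gt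
    have h5 := hP4 (h.trans hwm)
    have h6 : (1 - P) * stageCost τ (min (6 / 5 * w) s) ≤
        3 / 4 * stageCost τ (min (6 / 5 * w) s) := by
      gcongr
      linarith
    linarith

/-- Bound, in units of `36 √N`, for the expected number of queries until the maximum is found, when
`t` indices beat the threshold and the exponential search has just been restarted. -/
noncomputable def rankCost (t : ℕ) : ℝ := if t = 0 then 0 else 2 - 1 / √t

theorem rankCost_mono {t u : ℕ} (h : t ≤ u) : rankCost t ≤ rankCost u := by
  have hone : ∀ k : ℕ, k ≠ 0 → 1 ≤ √(k : ℝ) := fun k hk => by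
    rw [Real.one_le_sqrt]
    exact_mod_cast Nat.one_le_iff_ne_zero.2 hk
  unfold rankCost
  split_ifs with h1 h2 h2
  · exact le_rfl
  · have : 1 / √(u : ℝ) ≤ 1 := (div_le_one (by linarith [hone u h2])).2 (hone u h2)
    linarith
  · omega
  · have := hone t h1
    gcongr

theorem rankCost_le_two (t : ℕ) : rankCost t ≤ 2 := by
  unfold rankCost
  split_ifs
  · norm_num
  · have : 0 ≤ 1 / √(t : ℝ) := by positivity
    linarith

theorem rankCost_succ_step (t : ℕ) :
    2 * (t : ℝ) - 2 * √t + rankCost t ≤ 2 * ((t + 1 : ℕ) : ℝ) - 2 * √((t + 1 : ℕ) : ℝ) := by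
  rcases Nat.eq_zero_or_pos t with rfl | ht
  · simp [rankCost]
  · have h1 : 0 < √(t : ℝ) := Real.sqrt_pos.2 (Nat.cast_pos.2 ht)
    have h2 : √(t : ℝ) ^ 2 = t := Real.sq_sqrt (Nat.cast_nonneg t)
    have h3 : √((t + 1 : ℕ) : ℝ) ^ 2 = t + 1 := by
      rw [Real.sq_sqrt (Nat.cast_nonneg _)]
      push_cast
      ring
    have h4 : √((t + 1 : ℕ) : ℝ) ≤ √(t : ℝ) + 1 / (2 * √(t : ℝ)) := by
      refine abs_le_of_sq_le_sq' ?_ (by positivity) |>.2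
      rw [h3, add_sq, h2]
      have : 2 * √(t : ℝ) * (1 / (2 * √(t : ℝ))) = 1 := by field_simp
      rw [this]
      have : 0 ≤ (1 / (2 * √(t : ℝ))) ^ 2 := by positivity
      linarith
    have h5 : 1 / (2 * √(t : ℝ)) = 1 / √(t : ℝ) / 2 := by field_simp
    rw [rankCost, if_neg ht.ne']
    push_cast at h4 ⊢
    rw [h5] at h4
    linarith

/-- The threshold index that succeeds a uniformly random choice among `t` candidates has a uniformly
random rank; ties only help. -/
theorem sum_rankCost_le {X : Type*} [DecidableEq X] (L : X → ℕ) (s : Finset X) :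
    ∑ y ∈ s, rankCost (s.filter fun x => L y < L x).card ≤ 2 * (s.card : ℝ) - 2 * √s.card := by
  induction s using Finset.induction_on_min_value L with
  | empty => simp
  | insert a s ha hmin ih =>
    rw [Finset.sum_insert ha, Finset.card_insert_of_notMem ha]
    have h1 : rankCost ((insert a s).filter fun x => L a < L x).card ≤ rankCost s.card := by
      refine rankCost_mono (Finset.card_le_card fun x hx => ?_)
      rw [Finset.mem_filter, Finset.mem_insert] at hx
      rcases hx.1 with rfl | h
      · exact absurd hx.2 (lt_irrefl _)
      · exact h
    have h2 : ∑ y ∈ s, rankCost ((insert a s).filter fun x => L y < L x).card =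
        ∑ y ∈ s, rankCost (s.filter fun x => L y < L x).card := by
      refine Finset.sum_congr rfl fun y hy => ?_
      rw [Finset.filter_insert, if_neg (hmin y hy).not_gt]
    rw [h2]
    linarith [rankCost_succ_step s.card]

variable {X : Type*} [Fintype X]

/-- The indices whose value beats the threshold `v`. -/
def above (L : X → ℕ) (v : ℕ) : Finset X := Finset.univ.filter fun x => v < L x

theorem mem_above {L : X → ℕ} {v : ℕ} {x : X} : x ∈ above L v ↔ v < L x := by
  simp [above]

theorem above_eq_filter_above {L : X → ℕ} {v : ℕ} {y : X} (hy : y ∈ above L v) :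
    above L (L y) = (above L v).filter fun x => L y < L x := by
  ext x
  simp only [mem_above, Finset.mem_filter] at *
  exact ⟨fun h => ⟨hy.trans h, h⟩, fun h => h.2⟩

/-- The potential of the search with threshold `v` and width `w`: a bound for the expected number of
queries until the maximum is found. It is the cost of the current stage plus the cost, averaged over
the next threshold index, of the later stages. -/
noncomputable def searchPotential (L : X → ℕ) (v : ℕ) (w : ℝ) : ℝ :=
  if (above L v).card = 0 then 0
  else stageCost (√(Fintype.card X / (above L v).card)) w +
    72 * √(Fintype.card X) * (1 - 1 / √(above L v).card)

theorem searchPotential_nonneg (L : X → ℕ) (v : ℕ) {w : ℝ} (hw : 0 ≤ w) :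
    0 ≤ searchPotential L v w := by
  unfold searchPotential
  split_ifs with h
  · exact le_rfl
  · have h1 : 1 ≤ √((above L v).card : ℝ) := by
      rw [Real.one_le_sqrt]
      exact_mod_cast Nat.one_le_iff_ne_zero.2 h
    have h2 : 1 / √((above L v).card : ℝ) ≤ 1 := (div_le_one (by linarith)).2 h1
    have := stageCost_nonneg (τ := √(Fintype.card X / (above L v).card)) hw
    have : 0 ≤ 72 * √(Fintype.card X : ℝ) * (1 - 1 / √(above L v).card) :=
      mul_nonneg (by positivity) (by linarith)
    linarith

theorem searchPotential_one_le (L : X → ℕ) (v : ℕ) :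
    searchPotential L v 1 ≤ 36 * √(Fintype.card X) * rankCost (above L v).card := by
  unfold searchPotential rankCost
  split_ifs with h
  · simp
  · have ht : (0 : ℝ) < (above L v).card := Nat.cast_pos.2 (Nat.pos_of_ne_zero h)
    have hτ : 1 ≤ √(Fintype.card X / (above L v).card : ℝ) := by
      rw [Real.one_le_sqrt, one_le_div ht]
      exact_mod_cast Finset.card_le_univ _
    have h1 := stageCost_one_le hτ
    rw [Real.sqrt_div (Nat.cast_nonneg _)] at h1 ⊢
    have h2 : 36 * √(Fintype.card X : ℝ) * (2 - 1 / √(above L v).card) =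
        36 * (√(Fintype.card X : ℝ) / √(above L v).card) +
          72 * √(Fintype.card X : ℝ) * (1 - 1 / √(above L v).card) := by ring
    linarith

theorem sum_searchPotential_le (L : X → ℕ) (v : ℕ) :
    ∑ y ∈ above L v, searchPotential L (L y) 1 ≤
      (above L v).card * (72 * √(Fintype.card X) * (1 - 1 / √(above L v).card)) := by
  classical
  have h1 : ∑ y ∈ above L v, searchPotential L (L y) 1 ≤
      ∑ y ∈ above L v, 36 * √(Fintype.card X) *
        rankCost ((above L v).filter fun x => L y < L x).card := by
    refine Finset.sum_le_sum fun y hy => ?_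
    rw [← above_eq_filter_above hy]
    exact searchPotential_one_le L (L y)
  rw [← Finset.mul_sum] at h1
  have h2 : 36 * √(Fintype.card X : ℝ) *
      ∑ y ∈ above L v, rankCost ((above L v).filter fun x => L y < L x).card ≤
      36 * √(Fintype.card X : ℝ) * (2 * ((above L v).card : ℝ) - 2 * √(above L v).card) := by
    gcongr
    exact sum_rankCost_le L _
  refine (h1.trans h2).trans_eq ?_
  linear_combination (72 * √(Fintype.card X : ℝ)) * Real.div_sqrt (x := ((above L v).card : ℝ))

end Potential

/-! ### Analysis of a search run -/

section Run

open scoped ENNReal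

variable {X : Type*} [Fintype X]

/-- The Grover angle, `sin² θ = t / N`, for `t` marked indices out of `N`. -/
noncomputable def groverAngle (L : X → ℕ) (v : ℕ) : ℝ :=
  Real.arcsin (√(above L v).card / √(Fintype.card X))

/-- Squared amplitudes are uniform on the marked indices and on the unmarked ones. -/
theorem sum_groverAmp_sq_mul [Nonempty X] (L : X → ℕ) (v : ℕ) (h0 : (above L v).card ≠ 0)
    (hN : (above L v).card < Fintype.card X) (j : ℕ) (g : X → ℝ) :
    ∑ x, groverAmp (fun x => decide (v < L x)) j x ^ 2 * g x =
      Real.sin ((2 * j + 1) * groverAngle L v) ^ 2 / (above L v).card * ∑ x ∈ above L v, g x +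
      (1 - Real.sin ((2 * j + 1) * groverAngle L v) ^ 2) / (Fintype.card X - (above L v).card) *
        ∑ x with ¬ v < L x, g x := by
  have hcard : (above L v).card + (Finset.univ.filter fun x => ¬ v < L x).card =
      Fintype.card X := Finset.card_filter_add_card_filter_not _
  set u := (Finset.univ.filter fun x => ¬ v < L x).card with hu
  have htp : (0 : ℝ) < (above L v).card := Nat.cast_pos.2 (Nat.pos_of_ne_zero h0)
  have hup : (0 : ℝ) < u := Nat.cast_pos.2 (by omega)
  have hcR : ((above L v).card : ℝ) + u = Fintype.card X := by exact_mod_cast hcard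
  have hNp : (0 : ℝ) < Fintype.card X := by linarith
  have hle : √((above L v).card : ℝ) / √(Fintype.card X) ≤ 1 := by
    rw [div_le_one (Real.sqrt_pos.2 hNp)]
    exact Real.sqrt_le_sqrt (by linarith)
  have hs : Real.sin (groverAngle L v) = √(above L v).card / √(Fintype.card X) :=
    Real.sin_arcsin (le_trans (by norm_num) (by positivity : (0 : ℝ) ≤ _)) hle
  have hc : Real.cos (groverAngle L v) = √u / √(Fintype.card X) := by
    rw [groverAngle, Real.cos_arcsin, div_pow, Real.sq_sqrt htp.le, Real.sq_sqrt hNp.le,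
      ← Real.sqrt_div hup.le]
    congr 1
    field_simp
    linarith
  rw [groverAmp_eq _ (above L v).card u (by simp [above]) (by simp [hu]) (Nat.pos_of_ne_zero h0)
    (by omega) (groverAngle L v) hs hc j, ← Finset.sum_filter_add_sum_filter_not _ fun x => v < L x,
    Finset.mul_sum, Finset.mul_sum]
  congr 1
  · refine Finset.sum_congr rfl fun x hx => ?_
    simp only [mem_above.1 hx, decide_true, if_true, div_pow, Real.sq_sqrt htp.le]
  · refine Finset.sum_congr rfl fun x hx => ?_
    simp only [(Finset.mem_filter.1 hx).2, decide_false, Bool.false_eq_true, if_false, div_pow,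
      Real.sq_sqrt hup.le, Real.cos_sq', ← hcR, add_sub_cancel_left]

theorem sum_groverAmp_sq [Nonempty X] (L : X → ℕ) (v : ℕ) (h0 : (above L v).card ≠ 0)
    (hN : (above L v).card < Fintype.card X) (j : ℕ) :
    ∑ x, groverAmp (fun x => decide (v < L x)) j x ^ 2 = 1 := by
  have h := sum_groverAmp_sq_mul L v h0 hN j fun _ => 1
  have hcard : (above L v).card + (Finset.univ.filter fun x => ¬ v < L x).card =
      Fintype.card X := Finset.card_filter_add_card_filter_not _
  have hcR : ((Finset.univ.filter fun x => ¬ v < L x).card : ℝ) =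
      Fintype.card X - (above L v).card := by
    rw [← hcard]
    push_cast
    ring
  have htp : ((above L v).card : ℝ) ≠ 0 := Nat.cast_ne_zero.2 h0
  have hup : (Fintype.card X : ℝ) - (above L v).card ≠ 0 := by
    rw [sub_ne_zero]
    exact_mod_cast hN.ne'
  simp only [mul_one, Finset.sum_const, nsmul_eq_mul, hcR, div_mul_cancel₀ _ htp,
    div_mul_cancel₀ _ hup, add_sub_cancel] at h
  exact h

theorem sum_two_mul_add_one (m : ℕ) : ∑ j ∈ Finset.range m, (2 * (j : ℝ) + 1) = (m : ℝ) * m := by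
  induction m with
  | zero => simp
  | succ m ih =>
    rw [Finset.sum_range_succ, ih]
    push_cast
    ring

/-- The potential decreases, on average, by at least the number of queries of a round. -/
theorem searchPotential_round [Nonempty X] (L : X → ℕ) (v : ℕ) (h0 : (above L v).card ≠ 0)
    (hN : (above L v).card < Fintype.card X) {w : ℝ} (hw : 1 ≤ w) {m : ℕ} (hm : m = ⌈w⌉₊) :
    ∑ j ∈ Finset.range m, (m : ℝ)⁻¹ * (2 * j + 1 +
      ∑ x, groverAmp (fun x => decide (v < L x)) j x ^ 2 *
        if v < L x then searchPotential L (L x) 1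
        else searchPotential L v (min (6 / 5 * w) (√(Fintype.card X)))) ≤
      searchPotential L v w := by
  have htp : (0 : ℝ) < (above L v).card := Nat.cast_pos.2 (Nat.pos_of_ne_zero h0)
  have htN : ((above L v).card : ℝ) < Fintype.card X := by exact_mod_cast hN
  have hNp : (0 : ℝ) < Fintype.card X := by linarith
  set θ := groverAngle L v with hθ
  set w' := min (6 / 5 * w) (√(Fintype.card X)) with hw'
  set D := 72 * √(Fintype.card X : ℝ) * (1 - 1 / √(above L v).card) with hD
  set τ := √(Fintype.card X / (above L v).card : ℝ) with hτ
  have hpot : ∀ z, searchPotential L v z = stageCost τ z + D := fun z => if_neg h0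
  have hsinlt : √((above L v).card : ℝ) / √(Fintype.card X) < 1 := by
    rw [div_lt_one (Real.sqrt_pos.2 hNp)]
    exact Real.sqrt_lt_sqrt htp.le htN
  have hsinpos : 0 < √((above L v).card : ℝ) / √(Fintype.card X) :=
    div_pos (Real.sqrt_pos.2 htp) (Real.sqrt_pos.2 hNp)
  have hθ0 : 0 < θ := Real.arcsin_pos.2 hsinpos
  have hθ1 : θ < Real.pi / 2 := Real.arcsin_lt_pi_div_two.2 hsinlt
  have hsin : Real.sin θ = √(above L v).card / √(Fintype.card X) :=
    Real.sin_arcsin (by linarith) hsinlt.le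
  have hwm : w ≤ m := hm ▸ Nat.le_ceil w
  have hmw : (m : ℝ) ≤ w + 1 := hm ▸ (Nat.ceil_lt_add_one (by linarith)).le
  have hm0 : (0 : ℝ) < m := by linarith
  set P := (m : ℝ)⁻¹ * ∑ j ∈ Finset.range m, Real.sin ((2 * j + 1) * θ) ^ 2 with hP
  have hP0 : 0 ≤ P :=
    mul_nonneg (inv_nonneg.2 hm0.le) (Finset.sum_nonneg fun _ _ => sq_nonneg _)
  have hP4 : τ ≤ m → 1 / 4 ≤ P := by
    intro h
    have h1 : 1 ≤ m * Real.sin θ := by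
      rw [hτ, Real.sqrt_div hNp.le, div_le_iff₀ (Real.sqrt_pos.2 htp)] at h
      rw [hsin, ← mul_div_assoc, one_le_div (Real.sqrt_pos.2 hNp)]
      exact h
    have h2 := quarter_le_sum_sin_sq hθ0 hθ1 h1
    rw [hP, ← div_eq_inv_mul, le_div_iff₀ hm0]
    linarith
  have hτs : τ ≤ √(Fintype.card X) := by
    refine Real.sqrt_le_sqrt (div_le_self hNp.le ?_)
    exact_mod_cast Nat.one_le_iff_ne_zero.2 h0
  have hs1 : 1 ≤ √(Fintype.card X : ℝ) := by
    rw [Real.one_le_sqrt]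
    exact_mod_cast Fintype.card_pos
  have hstage := add_stageCost_le hτs hw hs1 hwm hmw hP0 hP4
  -- the expected potential after `j` iterations
  have hj : ∀ j : ℕ, ∑ x, groverAmp (fun x => decide (v < L x)) j x ^ 2 *
        (if v < L x then searchPotential L (L x) 1 else searchPotential L v w') ≤
      D + (1 - Real.sin ((2 * j + 1) * θ) ^ 2) * stageCost τ w' := by
    intro j
    rw [sum_groverAmp_sq_mul L v h0 hN j]
    have e1 : ∑ x ∈ above L v,
        (if v < L x then searchPotential L (L x) 1 else searchPotential L v w') =
        ∑ x ∈ above L v, searchPotential L (L x) 1 :=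
      Finset.sum_congr rfl fun x hx => if_pos (mem_above.1 hx)
    have e2 : ∑ x with ¬ v < L x,
        (if v < L x then searchPotential L (L x) 1 else searchPotential L v w') =
        (Fintype.card X - (above L v).card) * (stageCost τ w' + D) := by
      have hcard : (above L v).card + (Finset.univ.filter fun x => ¬ v < L x).card =
          Fintype.card X := Finset.card_filter_add_card_filter_not _
      rw [Finset.sum_congr rfl fun x hx => if_neg (Finset.mem_filter.1 hx).2, Finset.sum_const,
        nsmul_eq_mul, hpot, ← hcard]
      push_cast
      ring
    rw [e1, e2, ← hθ]
    have h1 := sum_searchPotential_le L v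
    have h2 : Real.sin ((2 * j + 1) * θ) ^ 2 / (above L v).card *
        ∑ x ∈ above L v, searchPotential L (L x) 1 ≤
        Real.sin ((2 * j + 1) * θ) ^ 2 / (above L v).card * ((above L v).card * D) := by
      gcongr
    rw [← mul_assoc, div_mul_cancel₀ _ htp.ne'] at h2
    rw [← mul_assoc, div_mul_cancel₀ _ (sub_pos.2 htN).ne']
    linarith
  set T := ∑ j ∈ Finset.range m, Real.sin ((2 * j + 1) * θ) ^ 2 with hsum
  have htotal : ∑ j ∈ Finset.range m, (2 * (j : ℝ) + 1 +
      (D + (1 - Real.sin ((2 * j + 1) * θ) ^ 2) * stageCost τ w')) =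
      m * m + (m * D + (m - T) * stageCost τ w') := by
    rw [Finset.sum_add_distrib, sum_two_mul_add_one, Finset.sum_add_distrib, Finset.sum_const,
      ← Finset.sum_mul, Finset.sum_sub_distrib]
    simp [hsum]
  calc _ ≤ ∑ j ∈ Finset.range m, (m : ℝ)⁻¹ * (2 * j + 1 +
          (D + (1 - Real.sin ((2 * j + 1) * θ) ^ 2) * stageCost τ w')) := by
        refine Finset.sum_le_sum fun j _ => ?_
        exact mul_le_mul_of_nonneg_left (add_le_add_right (hj j) _) (inv_nonneg.2 hm0.le)
    _ = m + (1 - P) * stageCost τ w' + D := by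
        rw [← Finset.mul_sum, htotal, hP]
        field_simp
        ring
    _ ≤ searchPotential L v w := by
        rw [hpot]
        linarith

variable {K : Type*} [DecidableEq X] [Nonempty X] [Fintype K] [DecidableEq K]
  {G : Gate (X × K)} {k₀ : K} {κ : X → K} {val : K → ℕ}

/-- The pair of an index and its value, the latter being the largest one. -/
def IsMaxPair (L : X → ℕ) (x : X × ℕ) : Prop := x.2 = L x.1 ∧ ∀ z, L z ≤ x.2

theorem bind_iterate_eq {α : Type*} (k : α → PMF α) (n : ℕ) (p : PMF α) :
    (fun p : PMF α => p.bind k)^[n] p =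
      p.bind fun a => (fun p : PMF α => p.bind k)^[n] (PMF.pure a) := by
  induction n generalizing p with
  | zero => simp
  | succ n ih =>
    rw [Function.iterate_succ_apply, ih, PMF.bind_bind]
    congr 1
    ext1 a
    rw [Function.iterate_succ_apply, PMF.pure_bind, ← ih]

theorem support_searchRound
    (hG : ∀ x, (G : Matrix _ _ ℂ).mulVec (ket (x, k₀)) = ket (x, κ x)) {x y : SearchMem X}
    (hx : x.value = val (κ x.best)) (hy : y ∈ (searchRound G k₀ val x).support) :
    y.value = val (κ y.best) ∧ x.value ≤ y.value := by
  rw [searchRound, PMF.mem_support_bind_iff] at hy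
  obtain ⟨j, -, hy⟩ := hy
  split_ifs at hy with h
  · rw [PMF.support_map] at hy
    obtain ⟨z, hz, rfl⟩ := hy
    have hv := support_groverSample hG val x.value j hz
    dsimp only
    split_ifs with h'
    · exact ⟨hv, h'.le⟩
    · exact ⟨hx, le_rfl⟩
  · rw [PMF.support_pure, Set.mem_singleton_iff] at hy
    subst hy
    exact ⟨hx, le_rfl⟩

theorem support_searchRound_iterate
    (hG : ∀ x, (G : Matrix _ _ ℂ).mulVec (ket (x, k₀)) = ket (x, κ x)) (n : ℕ)
    {x y : SearchMem X} (hx : x.value = val (κ x.best))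
    (hy : y ∈ ((fun p : PMF (SearchMem X) => p.bind (searchRound G k₀ val))^[n]
      (PMF.pure x)).support) :
    y.value = val (κ y.best) ∧ x.value ≤ y.value := by
  induction n generalizing y with
  | zero =>
    rw [Function.iterate_zero, id, PMF.support_pure, Set.mem_singleton_iff] at hy
    subst hy
    exact ⟨hx, le_rfl⟩
  | succ n ih =>
    rw [Function.iterate_succ_apply', PMF.mem_support_bind_iff] at hy
    obtain ⟨z, hz, hy⟩ := hy
    have h1 := ih hz
    have h2 := support_searchRound hG h1.1 hy
    exact ⟨h2.1, h1.2.trans h2.2⟩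

theorem support_searchRun
    (hG : ∀ x, (G : Matrix _ _ ℂ).mulVec (ket (x, k₀)) = ket (x, κ x)) (B : ℕ) {x : X × ℕ}
    (hx : x ∈ (searchRun G k₀ val B).support) : x.2 = val (κ x.1) := by
  rw [searchRun, bind_iterate_eq, PMF.support_map] at hx
  obtain ⟨y, hy, rfl⟩ := hx
  rw [PMF.mem_support_bind_iff] at hy
  obtain ⟨z, hz, hy⟩ := hy
  rw [PMF.support_map] at hz
  obtain ⟨u, hu, rfl⟩ := hz
  exact (support_searchRound_iterate hG B (support_groverSample hG val 0 0 hu) hy).1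

/-- Markov's inequality for the budgeted search: with `left` out of `B` queries left, the search
misses the maximum with probability at most `(Φ + B - left) / B`, where `Φ` is the potential. When
a round does not fit into the budget, this bound is at least `1`. -/
theorem failProb_searchRound_iterate
    (hG : ∀ x, (G : Matrix _ _ ℂ).mulVec (ket (x, k₀)) = ket (x, κ x)) {B : ℕ} (hB : 0 < B) (n : ℕ)
    (x : SearchMem X) (hx : x.value = val (κ x.best)) (hw : 1 ≤ x.width) (hleft : x.left ≤ n)
    (hleftB : x.left ≤ B) :
    failProb ((fun p : PMF (SearchMem X) => p.bind (searchRound G k₀ val))^[n] (PMF.pure x))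
        (fun y => IsMaxPair (fun z => val (κ z)) (y.best, y.value)) ≤
      ENNReal.ofReal
        ((searchPotential (fun z => val (κ z)) x.value x.width + B - x.left) / B) := by
  have hB' : (0 : ℝ) < B := Nat.cast_pos.2 hB
  induction n generalizing x with
  | zero =>
    have hl : x.left = 0 := by omega
    refine (failProb_le_one _ _).trans ?_
    rw [ENNReal.one_le_ofReal, le_div_iff₀ hB', hl]
    have := searchPotential_nonneg (fun z => val (κ z)) x.value (by linarith : 0 ≤ x.width)
    push_cast
    linarith
  | succ n ih =>
    set L : X → ℕ := fun z => val (κ z) with hL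
    by_cases h0 : (above L x.value).card = 0
    · -- the threshold is the maximum already, and stays it
      rw [failProb_eq_zero]
      · exact zero_le
      · intro y hy
        have h := support_searchRound_iterate hG (n + 1) hx hy
        refine ⟨h.1, fun z => le_trans ?_ h.2⟩
        by_contra hz
        rw [Finset.card_eq_zero] at h0
        exact Finset.notMem_empty z (h0 ▸ mem_above.2 (not_le.1 hz))
    have hN : (above L x.value).card < Fintype.card X := by
      refine Finset.card_lt_univ_of_notMem (x := x.best) fun h => ?_
      have := mem_above.1 h
      exact absurd hx this.ne
    have hs1 : 1 ≤ √(Fintype.card X : ℝ) := by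
      rw [Real.one_le_sqrt]
      exact_mod_cast Fintype.card_pos
    have hw' : 1 ≤ min (6 / 5 * x.width) (√(Fintype.card X : ℝ)) := le_min (by linarith) hs1
    have hm : max 1 ⌈x.width⌉₊ = ⌈x.width⌉₊ :=
      max_eq_right (Nat.one_le_ceil_iff.2 (by linarith))
    have hm0 : (0 : ℝ) < (⌈x.width⌉₊ : ℝ) := Nat.cast_pos.2 (Nat.ceil_pos.2 (by linarith))
    set w' := min (6 / 5 * x.width) (√(Fintype.card X : ℝ)) with hw'_def
    set m := ⌈x.width⌉₊ with hm_def
    rw [Function.iterate_succ_apply, PMF.pure_bind, bind_iterate_eq, failProb_bind, searchRound,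
      expect_bind]
    refine (expect_uniformOfFinset _ _ _).trans_le ?_
    rw [hm, Finset.card_range]
    -- each value of `j` contributes at most the real number `E j`
    set E : ℕ → ℝ := fun j => (2 * j + 1 +
      ∑ z, groverAmp (fun z => decide (x.value < L z)) j z ^ 2 *
        (if x.value < L z then searchPotential L (L z) 1 else searchPotential L x.value w') +
        (B - x.left)) / B with hE
    have hnext : ∀ z, 0 ≤
        (if x.value < L z then searchPotential L (L z) 1 else searchPotential L x.value w') := by
      intro z
      split_ifs
      · exact searchPotential_nonneg _ _ zero_le_one
      · exact searchPotential_nonneg _ _ (by linarith)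
    have hsumnn : ∀ j : ℕ, 0 ≤ ∑ z, groverAmp (fun z => decide (x.value < L z)) j z ^ 2 *
        (if x.value < L z then searchPotential L (L z) 1 else searchPotential L x.value w') :=
      fun j => Finset.sum_nonneg fun z _ => mul_nonneg (sq_nonneg _) (hnext z)
    have key : ∀ j : ℕ, expect
        (if 2 * j + 1 ≤ x.left then
          (groverSample G k₀ val x.value j).map fun y =>
            if x.value < y.2 then (⟨y.1, y.2, 1, x.left - (2 * j + 1)⟩ : SearchMem X)
            else ⟨x.best, x.value, w', x.left - (2 * j + 1)⟩
        else PMF.pure ⟨x.best, x.value, x.width, 0⟩)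
        (fun y => failProb
          ((fun p : PMF (SearchMem X) => p.bind (searchRound G k₀ val))^[n] (PMF.pure y))
          fun y => IsMaxPair L (y.best, y.value)) ≤ ENNReal.ofReal (E j) := by
      intro j
      split_ifs with hfit
      · rw [expect_map, expect_groverSample hG]
        have hc : ((x.left - (2 * j + 1) : ℕ) : ℝ) = x.left - (2 * j + 1) := by
          push_cast [Nat.cast_sub hfit]
          ring
        have hbound : ∀ z, failProb
            ((fun p : PMF (SearchMem X) => p.bind (searchRound G k₀ val))^[n] (PMF.pure
              (if x.value < val (κ z) then
                (⟨z, val (κ z), 1, x.left - (2 * j + 1)⟩ : SearchMem X)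
              else ⟨x.best, x.value, w', x.left - (2 * j + 1)⟩)))
            (fun y => IsMaxPair L (y.best, y.value)) ≤
            ENNReal.ofReal (((if x.value < L z then searchPotential L (L z) 1
              else searchPotential L x.value w') + B - (x.left - (2 * j + 1))) / B) := by
          intro z
          by_cases hz : x.value < val (κ z)
          · have h := ih ⟨z, val (κ z), 1, x.left - (2 * j + 1)⟩ rfl le_rfl
              (by simp only; omega) (by simp only; omega)
            simpa only [hL, hz, if_true, hc] using h
          · have h := ih ⟨x.best, x.value, w', x.left - (2 * j + 1)⟩ hx hw'
              (by simp only; omega) (by simp only; omega)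
            simpa only [hL, hz, if_false, hc] using h
        have hfit' : (2 * (j : ℝ) + 1) ≤ x.left := by exact_mod_cast hfit
        calc _ ≤ ∑ z, ENNReal.ofReal (groverAmp (fun z => decide (x.value < L z)) j z ^ 2) *
              ENNReal.ofReal (((if x.value < L z then searchPotential L (L z) 1
              else searchPotential L x.value w') + B - (x.left - (2 * j + 1))) / B) :=
              Finset.sum_le_sum fun z _ => mul_le_mul_right (hbound z) _
          _ ≤ ∑ z, ENNReal.ofReal (groverAmp (fun z => decide (x.value < L z)) j z ^ 2 *
              (((if x.value < L z then searchPotential L (L z) 1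
              else searchPotential L x.value w') + B - (x.left - (2 * j + 1))) / B)) :=
              Finset.sum_le_sum fun z _ => (ENNReal.ofReal_mul (sq_nonneg _)).ge
          _ = ENNReal.ofReal (E j) := by
              rw [← ENNReal.ofReal_sum_of_nonneg]
              · congr 1
                have h1 := sum_groverAmp_sq L x.value h0 hN j
                simp only [hE, mul_div_assoc', ← Finset.sum_div, add_sub_assoc, mul_add,
                  Finset.sum_add_distrib]
                rw [← Finset.sum_mul, h1]
                ring
              · intro z _
                have hlB : (x.left : ℝ) ≤ B := by exact_mod_cast hleftB
                refine mul_nonneg (sq_nonneg _) (div_nonneg ?_ hB'.le)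
                linarith [hnext z, (Nat.cast_nonneg j : (0 : ℝ) ≤ j)]
      · rw [expect_pure]
        refine (failProb_le_one _ _).trans ?_
        rw [ENNReal.one_le_ofReal, hE, le_div_iff₀ hB']
        have h1 : (x.left : ℝ) ≤ 2 * j + 1 := by exact_mod_cast (not_le.1 hfit).le
        linarith [hsumnn j]
    have hround := searchPotential_round L x.value h0 hN hw hm_def
    have hlB : (x.left : ℝ) ≤ B := by exact_mod_cast hleftB
    have hEnn : ∀ j, 0 ≤ E j := fun j => by
      refine div_nonneg ?_ hB'.le
      linarith [hsumnn j, (Nat.cast_nonneg j : (0 : ℝ) ≤ j)]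
    calc _ ≤ ∑ j ∈ Finset.range m, (m : ℝ≥0∞)⁻¹ * ENNReal.ofReal (E j) :=
          Finset.sum_le_sum fun j _ => mul_le_mul_right (key j) _
      _ = ENNReal.ofReal (∑ j ∈ Finset.range m, (m : ℝ)⁻¹ * E j) := by
          rw [ENNReal.ofReal_sum_of_nonneg fun j _ => mul_nonneg (inv_nonneg.2 hm0.le) (hEnn j)]
          refine Finset.sum_congr rfl fun j _ => ?_
          rw [ENNReal.ofReal_mul (inv_nonneg.2 hm0.le), ENNReal.ofReal_inv_of_pos hm0,
            ENNReal.ofReal_natCast]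
      _ ≤ _ := by
          refine ENNReal.ofReal_le_ofReal ?_
          have hsum : ∑ j ∈ Finset.range m, (m : ℝ)⁻¹ * E j =
              (∑ j ∈ Finset.range m, (m : ℝ)⁻¹ * (2 * j + 1 +
                ∑ z, groverAmp (fun z => decide (x.value < L z)) j z ^ 2 *
                  if x.value < L z then searchPotential L (L z) 1
                  else searchPotential L x.value w') + (B - x.left)) / B := by
            have hc : (B : ℝ) - x.left = ∑ j ∈ Finset.range m, (m : ℝ)⁻¹ * (B - x.left) := by
              rw [Finset.sum_const, Finset.card_range, nsmul_eq_mul, mul_inv_cancel_left₀ hm0.ne']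
            rw [hc, ← Finset.sum_add_distrib, Finset.sum_div]
            refine Finset.sum_congr rfl fun j _ => ?_
            rw [hE]
            ring
          rw [hsum, add_sub_assoc]
          gcongr

/-- A single run misses the maximum with probability at most `1/2`. -/
theorem failProb_searchRun
    (hG : ∀ x, (G : Matrix _ _ ℂ).mulVec (ket (x, k₀)) = ket (x, κ x)) {B : ℕ}
    (hB : 146 * √(Fintype.card X : ℝ) ≤ B) :
    failProb (searchRun G k₀ val B) (IsMaxPair fun z => val (κ z)) ≤ ENNReal.ofReal (1 / 2) := by
  have hs1 : 1 ≤ √(Fintype.card X : ℝ) := by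
    rw [Real.one_le_sqrt]
    exact_mod_cast Fintype.card_pos
  have hB' : (0 : ℝ) < B := by linarith
  have hB0 : 0 < B := Nat.cast_pos.1 hB'
  rw [searchRun, failProb_map, bind_iterate_eq, failProb_bind, expect_map]
  refine expect_le_of_forall fun y hy => ?_
  refine (failProb_searchRound_iterate hG hB0 B _ (support_groverSample hG val 0 0 hy) le_rfl
    (Nat.sub_le _ _) (Nat.sub_le _ _)).trans (ENNReal.ofReal_le_ofReal ?_)
  have h1 := searchPotential_one_le (fun z => val (κ z)) y.2
  have h2 := rankCost_le_two (above (fun z => val (κ z)) y.2).card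
  have h3 : 36 * √(Fintype.card X : ℝ) * rankCost (above (fun z => val (κ z)) y.2).card ≤
      36 * √(Fintype.card X : ℝ) * 2 := by gcongr
  dsimp only
  rw [div_le_iff₀ hB', Nat.cast_sub hB0, Nat.cast_one]
  linarith

theorem support_bestOfRuns
    (hG : ∀ x, (G : Matrix _ _ ℂ).mulVec (ket (x, k₀)) = ket (x, κ x)) (B R : ℕ) {x : X × ℕ}
    (hx : x ∈ (bestOfRuns G k₀ val B R).support) : x.2 = val (κ x.1) := by
  induction R generalizing x with
  | zero => exact support_searchRun hG B hx
  | succ R ih =>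
    rw [bestOfRuns, PMF.mem_support_bind_iff] at hx
    obtain ⟨y, hy, hx⟩ := hx
    rw [PMF.support_map] at hx
    obtain ⟨z, hz, rfl⟩ := hx
    dsimp only
    split_ifs
    · exact support_searchRun hG B hz
    · exact ih hy

theorem failProb_bestOfRuns
    (hG : ∀ x, (G : Matrix _ _ ℂ).mulVec (ket (x, k₀)) = ket (x, κ x)) {B : ℕ}
    (hB : 146 * √(Fintype.card X : ℝ) ≤ B) (R : ℕ) :
    failProb (bestOfRuns G k₀ val B R) (IsMaxPair fun z => val (κ z)) ≤
      ENNReal.ofReal (1 / 2) ^ (R + 1) := by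
  classical
  induction R with
  | zero =>
    rw [zero_add, pow_one]
    exact failProb_searchRun hG hB
  | succ R ih =>
    -- the better one of two outcomes fails only if both do
    have hstep : ∀ x ∈ (bestOfRuns G k₀ val B R).support,
        failProb ((searchRun G k₀ val B).map fun y => if x.2 < y.2 then y else x)
          (IsMaxPair fun z => val (κ z)) ≤
        ENNReal.ofReal (1 / 2) * if IsMaxPair (fun z => val (κ z)) x then 0 else 1 := by
      intro x hx
      rw [failProb_map]
      split_ifs with hmax
      · rw [mul_zero, failProb_eq_zero]
        intro y hy
        rw [if_neg]
        · exact hmax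
        · rw [support_searchRun hG B hy]
          exact (hmax.2 y.1).not_gt
      · rw [mul_one]
        refine (failProb_mono fun y _ hy => ?_).trans (failProb_searchRun hG hB)
        have hle : x.2 ≤ y.2 := by
          rw [support_bestOfRuns hG B R hx]
          exact hy.2 x.1
        split_ifs with hlt
        · exact hy
        · refine ⟨support_bestOfRuns hG B R hx, fun z => (hy.2 z).trans ?_⟩
          exact not_lt.1 hlt
    rw [bestOfRuns, failProb_bind, pow_succ']
    refine (expect_mono hstep).trans ?_
    rw [expect_mul_left]
    gcongr
    exact ih

/-- `QMS_ζ` misses the maximum with probability at most `ζ`. -/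
theorem failProb_qms
    (hG : ∀ x, (G : Matrix _ _ ℂ).mulVec (ket (x, k₀)) = ket (x, κ x)) {ζ : ℝ} (hζ : 0 < ζ)
    (hζ1 : ζ < 1) :
    failProb (qms 146 G k₀ val ζ) (fun x => ∀ z, val (κ z) ≤ val (κ x)) ≤ ENNReal.ofReal ζ := by
  rw [qms, failProb_map]
  refine (failProb_mono fun x _ hx z => ?_).trans
    ((failProb_bestOfRuns hG (Nat.le_ceil _) _).trans ?_)
  · exact (hx.2 z).trans_eq hx.1
  · have hlog : 0 < Real.logb 2 (1 / ζ) :=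
      Real.logb_pos one_lt_two ((one_lt_div hζ).2 hζ1)
    rw [Nat.sub_add_cancel (Nat.one_le_iff_ne_zero.2 (Nat.ceil_pos.2 hlog).ne'),
      ← ENNReal.ofReal_pow (by norm_num)]
    refine ENNReal.ofReal_le_ofReal ?_
    have h1 := Nat.le_ceil (Real.logb 2 (1 / ζ))
    rw [Real.logb_le_iff_le_rpow one_lt_two (by positivity), Real.rpow_natCast] at h1
    rw [one_div ζ] at h1 ⊢
    rw [one_div, inv_pow]
    exact inv_le_of_inv_le₀ hζ h1

end Run

/-! ### Fixed-point errors -/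

section FixedPoint

variable {S A : Type*} [Fintype S] {H p q : ℕ}

/-- The fixed-point value of `Q_{h,s}(a)`, in units of `2^{-2p}`. -/
noncomputable def qFixed (p q : ℕ) (M : MDP S A H) (h : Fin H) (s : S) (v : S → ℝ) (a : A) : ℕ :=
  ∑ s', (fix p q (M.P h s a s')).val * (fix p q (v s')).val + 2 ^ p * (fix p q (M.r h s a)).val

theorem MDP.P_le_one (M : MDP S A H) (h : Fin H) (s : S) (a : A) (s' : S) : M.P h s a s' ≤ 1 := by
  rw [← M.P_sum h s a]
  exact Finset.single_le_sum (fun t _ => M.P_nonneg h s a t) (Finset.mem_univ s')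

theorem fix_val_eq {c : ℕ} (hc : c * 2 ^ p < 2 ^ q) {x : ℝ} (h1 : x ≤ c) :
    (fix p q x).val = ⌊(2 : ℝ) ^ p * x⌋₊ := by
  rw [fix, Fin.val_ofNat, Nat.mod_eq_of_lt]
  refine lt_of_le_of_lt ?_ hc
  have h2 : (2 : ℝ) ^ p * x ≤ ((c * 2 ^ p : ℕ) : ℝ) := by
    push_cast
    rw [mul_comm]
    gcongr
  exact (Nat.floor_le_floor h2).trans_eq (Nat.floor_natCast _)

theorem fix_val_le {c : ℕ} (hc : c * 2 ^ p < 2 ^ q) {x : ℝ} (h0 : 0 ≤ x) (h1 : x ≤ c) :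
    ((fix p q x).val : ℝ) ≤ 2 ^ p * x := by
  rw [fix_val_eq hc h1]
  exact Nat.floor_le (by positivity)

theorem le_fix_val_add_one {c : ℕ} (hc : c * 2 ^ p < 2 ^ q) {x : ℝ} (h1 : x ≤ c) :
    2 ^ p * x ≤ (fix p q x).val + 1 := by
  rw [fix_val_eq hc h1]
  exact (Nat.lt_floor_add_one _).le

/-- Fixed-point arithmetic rounds down. -/
theorem qFixed_le (M : MDP S A H) (h : Fin H) (s : S) {v : S → ℝ} (a : A)
    (hq : H * 2 ^ p < 2 ^ q) (h0 : ∀ s', 0 ≤ v s') (h1 : ∀ s', v s' ≤ H) :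
    (qFixed p q M h s v a : ℝ) ≤ (2 ^ p) ^ 2 * M.qvec h s v a := by
  have hH : (1 : ℝ) ≤ H := by exact_mod_cast h.pos
  have hr := fix_val_le hq (M.r_nonneg h s a) ((M.r_le_one h s a).trans hH)
  have hterm : ∀ s', ((fix p q (M.P h s a s')).val : ℝ) * (fix p q (v s')).val ≤
      (2 ^ p * M.P h s a s') * (2 ^ p * v s') := by
    intro s'
    have hP := fix_val_le hq (M.P_nonneg h s a s') ((M.P_le_one h s a s').trans hH)
    have hv := fix_val_le hq (h0 s') (h1 s')
    have := M.P_nonneg h s a s'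
    gcongr
  rw [qFixed, MDP.qvec]
  push_cast
  calc _ ≤ ∑ s', (2 ^ p * M.P h s a s') * (2 ^ p * v s') + 2 ^ p * (2 ^ p * M.r h s a) := by
        exact add_le_add (Finset.sum_le_sum fun s' _ => hterm s') (by gcongr)
    _ = _ := by
        rw [mul_add, Finset.mul_sum, add_comm]
        congr 1
        · ring
        · exact Finset.sum_congr rfl fun s' _ => by ring

/-- The rounding error is of the order of `2^p` units of `2^{-2p}`. -/
theorem le_qFixed_add (M : MDP S A H) (h : Fin H) (s : S) {v : S → ℝ} (a : A)
    (hq : H * 2 ^ p < 2 ^ q) (h0 : ∀ s', 0 ≤ v s') (h1 : ∀ s', v s' ≤ H) :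
    (2 ^ p) ^ 2 * M.qvec h s v a ≤
      qFixed p q M h s v a + 2 ^ p * (Fintype.card S * (H + 1) + 1) := by
  have hH : (1 : ℝ) ≤ H := by exact_mod_cast h.pos
  have hr := le_fix_val_add_one hq ((M.r_le_one h s a).trans hH)
  have hterm : ∀ s', (2 ^ p * M.P h s a s') * (2 ^ p * v s') ≤
      ((fix p q (M.P h s a s')).val : ℝ) * (fix p q (v s')).val + 2 ^ p * (H + 1) := by
    intro s'
    have hP := le_fix_val_add_one hq ((M.P_le_one h s a s').trans hH)
    have hP' := fix_val_le hq (M.P_nonneg h s a s') ((M.P_le_one h s a s').trans hH)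
    have hv := le_fix_val_add_one hq (h1 s')
    have hP1 : (2 : ℝ) ^ p * M.P h s a s' ≤ 2 ^ p * 1 := by
      gcongr
      exact M.P_le_one h s a s'
    have hvH : (2 : ℝ) ^ p * v s' ≤ 2 ^ p * H := by
      gcongr
      exact h1 s'
    have hv0 : 0 ≤ (2 : ℝ) ^ p * v s' := mul_nonneg (by positivity) (h0 s')
    have e1 : 2 ^ p * M.P h s a s' * (2 ^ p * v s') ≤
        ((fix p q (M.P h s a s')).val + 1) * (2 ^ p * v s') := by gcongr
    have e2 : ((fix p q (M.P h s a s')).val : ℝ) * (2 ^ p * v s') ≤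
        (fix p q (M.P h s a s')).val * ((fix p q (v s')).val + 1) := by gcongr
    linarith
  rw [qFixed, MDP.qvec]
  push_cast
  calc _ = ∑ s', (2 ^ p * M.P h s a s') * (2 ^ p * v s') + 2 ^ p * (2 ^ p * M.r h s a) := by
        rw [mul_add, Finset.mul_sum, add_comm]
        congr 1
        · exact Finset.sum_congr rfl fun s' _ => by ring
        · ring
    _ ≤ ∑ s', (((fix p q (M.P h s a s')).val : ℝ) * (fix p q (v s')).val + 2 ^ p * (H + 1)) +
          2 ^ p * ((fix p q (M.r h s a)).val + 1) := by
        gcongr with s'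
        exact hterm s'
    _ = _ := by
        rw [Finset.sum_add_distrib, Finset.sum_const, Finset.card_univ, nsmul_eq_mul]
        ring

/-- The accumulator does not overflow. -/
theorem qFixed_lt (M : MDP S A H) (h : Fin H) (s : S) {v : S → ℝ} (a : A)
    (hq : H * 2 ^ p < 2 ^ q) (h0 : ∀ s', 0 ≤ v s') (h1 : ∀ s', v s' ≤ H)
    (hQ : M.qvec h s v a ≤ H) : qFixed p q M h s v a < 2 ^ (2 * q) := by
  have hle := qFixed_le M h s a hq h0 h1
  have h2 : (qFixed p q M h s v a : ℝ) ≤ ((2 ^ p * (H * 2 ^ p) : ℕ) : ℝ) := by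
    refine hle.trans ?_
    push_cast
    calc (2 ^ p : ℝ) ^ 2 * M.qvec h s v a ≤ (2 ^ p) ^ 2 * H := by gcongr
      _ = _ := by ring
  have h3 : 2 ^ p ≤ H * 2 ^ p := Nat.le_mul_of_pos_left _ h.pos
  have h4 : qFixed p q M h s v a ≤ 2 ^ p * (H * 2 ^ p) := by exact_mod_cast h2
  calc qFixed p q M h s v a ≤ 2 ^ p * (H * 2 ^ p) := h4
    _ < 2 ^ q * 2 ^ q := Nat.mul_lt_mul_of_lt_of_lt (h3.trans_lt hq) hq
    _ = 2 ^ (2 * q) := by rw [two_mul, pow_add]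

end FixedPoint

/-! ### The circuit for `Q_{h,s}` -/

section Circuit

/-- The gate maps the basis vector `|x⟩` to the basis vector `|y⟩`. -/
def MapsKet {n : Type*} [Fintype n] [DecidableEq n] (U : Gate n) (x y : n) : Prop :=
  (U : Matrix n n ℂ).mulVec (ket x) = ket y

section Calculus

variable {n X Y : Type*} [Fintype n] [DecidableEq n] [Fintype X] [DecidableEq X] [Fintype Y]
  [DecidableEq Y]

theorem MapsKet.one (x : n) : MapsKet (1 : Gate n) x x := by
  rw [MapsKet, Submonoid.coe_one, Matrix.one_mulVec]

theorem MapsKet.mul {U V : Gate n} {x y z : n} (hU : MapsKet U y z) (hV : MapsKet V x y) :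
    MapsKet (U * V) x z := by
  rw [MapsKet, gate_mul_mulVec, hV, hU]

theorem MapsKet.inv {U : Gate n} {x y : n} (h : MapsKet U x y) : MapsKet U⁻¹ y x :=
  gate_inv_mulVec h

theorem mapsKet_permGate (σ : Equiv.Perm n) (x : n) : MapsKet (permGate σ) x (σ x) := by
  rw [MapsKet]
  ext y
  refine (mulVec_ket _ _ _).trans ?_
  simp [permGate, ket, Pi.single_apply]

theorem mapsKet_liftGate (e : n ≃ X × Y) {U : Gate X} {x y : n} (h : MapsKet U (e x).1 (e y).1)
    (h2 : (e y).2 = (e x).2) : MapsKet (liftGate e U) x y := by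
  rw [MapsKet]
  ext z
  have hU : (U : Matrix X X ℂ) (e z).1 (e x).1 = if (e z).1 = (e y).1 then 1 else 0 := by
    refine (mulVec_ket _ _ _).symm.trans ?_
    rw [show (U : Matrix X X ℂ).mulVec (ket (e x).1) = ket (e y).1 from h, ket, Pi.single_apply]
  refine (mulVec_ket _ _ _).trans ?_
  change (U : Matrix X X ℂ) (e z).1 (e x).1 * (1 : Matrix Y Y ℂ) (e z).2 (e x).2 = _
  rw [hU, Matrix.one_apply, ← h2, ket, Pi.single_apply]
  have hz : z = y ↔ (e z).1 = (e y).1 ∧ (e z).2 = (e y).2 := by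
    rw [← Prod.ext_iff, e.apply_eq_iff_eq]
  simp only [hz, ite_and]
  split_ifs <;> simp

end Calculus

theorem ofNat_add_ofNat (N : ℕ) [NeZero N] (a b : ℕ) :
    Fin.ofNat N a + Fin.ofNat N b = Fin.ofNat N (a + b) := by
  ext
  simp [Fin.val_add]

variable {S A : Type*} [Fintype S] [DecidableEq S] [Fintype A] [DecidableEq A] {H p q : ℕ}

theorem mapsKet_liftGate_mdpSplit {M : MDP S A H} {O : Gate (MDPReg S A H q)}
    (hO : IsMDPOracle p M O) (a : A) (s s' : S) (h : Fin H) (v : Word q) (acc : Word (2 * q)) :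
    MapsKet (liftGate mdpSplit O) (a, (⟨s, h, s', 0, 0, v, acc⟩ : Anc S H q))
      (a, ⟨s, h, s', fix p q (M.r h s a), fix p q (M.P h s a s'), v, acc⟩) :=
  mapsKet_liftGate _ (hO s a h s') rfl

theorem mapsKet_addTermGate {M : MDP S A H} {O : Gate (MDPReg S A H q)}
    {UV : Gate (S × Word q)} {v : S → ℝ} (hO : IsMDPOracle p M O) (hV : IsBinaryOracle p UV v)
    (a : A) (s t : S) (h : Fin H) (N : ℕ) :
    MapsKet (addTermGate O UV s t)
      (a, (⟨s, h, s, 0, 0, 0, Fin.ofNat (2 ^ (2 * q)) N⟩ : Anc S H q))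
      (a, ⟨s, h, s, 0, 0, 0,
        Fin.ofNat (2 ^ (2 * q)) (N + (fix p q (M.P h s a t)).val * (fix p q (v t)).val)⟩) := by
  have hswap : ∀ N', MapsKet (swapGate s t)
      (a, (⟨s, h, s, 0, 0, 0, N'⟩ : Anc S H q)) (a, ⟨s, h, t, 0, 0, 0, N'⟩) := by
    intro N'
    have h' : ∀ y : A × Anc S H q,
        MapsKet (swapGate s t) y (y.1, { y.2 with s' := Equiv.swap s t y.2.s' }) :=
      fun y => mapsKet_permGate _ y
    simpa using h' (a, ⟨s, h, s, 0, 0, 0, N'⟩)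
  have hquery : ∀ N', MapsKet (liftGate valueSplit UV)
      (a, (⟨s, h, t, fix p q (M.r h s a), fix p q (M.P h s a t), 0, N'⟩ : Anc S H q))
      (a, ⟨s, h, t, fix p q (M.r h s a), fix p q (M.P h s a t), fix p q (v t), N'⟩) :=
    fun N' => mapsKet_liftGate _ (hV t) rfl
  have hO' := fun N' => mapsKet_liftGate_mdpSplit hO a s t h 0 N'
  have hadd : MapsKet mulAddGate
      (a, (⟨s, h, t, fix p q (M.r h s a), fix p q (M.P h s a t), fix p q (v t),
        Fin.ofNat (2 ^ (2 * q)) N⟩ : Anc S H q))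
      (a, ⟨s, h, t, fix p q (M.r h s a), fix p q (M.P h s a t), fix p q (v t),
        Fin.ofNat (2 ^ (2 * q)) (N + (fix p q (M.P h s a t)).val * (fix p q (v t)).val)⟩) := by
    rw [← ofNat_add_ofNat]
    exact mapsKet_permGate _ _
  exact (((((((hswap _).inv.mul (hO' _).inv).mul (hquery _).inv).mul hadd).mul (hquery _)).mul
    (hO' _)).mul (hswap _))

theorem mapsKet_prod_addTermGate {M : MDP S A H} {O : Gate (MDPReg S A H q)}
    {UV : Gate (S × Word q)} {v : S → ℝ} (hO : IsMDPOracle p M O) (hV : IsBinaryOracle p UV v)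
    (a : A) (s : S) (h : Fin H) (l : List S) :
    MapsKet (l.map fun t => addTermGate O UV s t).prod
      (a, (⟨s, h, s, 0, 0, 0, Fin.ofNat (2 ^ (2 * q)) 0⟩ : Anc S H q))
      (a, ⟨s, h, s, 0, 0, 0, Fin.ofNat (2 ^ (2 * q))
        (l.map fun t => (fix p q (M.P h s a t)).val * (fix p q (v t)).val).sum⟩) := by
  induction l with
  | nil => exact MapsKet.one _
  | cons t l ih =>
    rw [List.map_cons, List.prod_cons, List.map_cons, List.sum_cons, Nat.add_comm]
    exact (mapsKet_addTermGate hO hV a s t h _).mul ih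

/-- The circuit computes the fixed-point value of `Q_{h,s}(a)` in its accumulator. -/
theorem mapsKet_qOracle {M : MDP S A H} {O : Gate (MDPReg S A H q)}
    {UV : Gate (S × Word q)} {v : S → ℝ} (hO : IsMDPOracle p M O) (hV : IsBinaryOracle p UV v)
    (a : A) (s : S) (h : Fin H) :
    MapsKet (qOracle p O UV s) (a, (⟨s, h, s, 0, 0, 0, 0⟩ : Anc S H q))
      (a, ⟨s, h, s, 0, 0, 0, Fin.ofNat (2 ^ (2 * q)) (qFixed p q M h s v a)⟩) := by
  have hsum := mapsKet_prod_addTermGate hO hV a s h Finset.univ.toList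
  rw [Finset.sum_map_toList] at hsum
  have hO' := fun N' => mapsKet_liftGate_mdpSplit hO a s s h 0 N'
  have hadd : ∀ N, MapsKet (addRewardGate p)
      (a, (⟨s, h, s, fix p q (M.r h s a), fix p q (M.P h s a s), 0,
        Fin.ofNat (2 ^ (2 * q)) N⟩ : Anc S H q))
      (a, ⟨s, h, s, fix p q (M.r h s a), fix p q (M.P h s a s), 0,
        Fin.ofNat (2 ^ (2 * q)) (N + 2 ^ p * (fix p q (M.r h s a)).val)⟩) := by
    intro N
    rw [← ofNat_add_ofNat]
    exact mapsKet_permGate _ _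
  exact (((hO' _).inv.mul (hadd _)).mul (hO' _)).mul hsum

end Circuit

/-! ### Dynamic programming -/

section DynamicProgramming

theorem prod_ite_le_eq {H h : ℕ} (hh : h < H) (f : Fin H → ℝ) :
    (∏ t : Fin H, if h ≤ (t : ℕ) then f t else 1) =
      f ⟨h, hh⟩ * ∏ t : Fin H, if h + 1 ≤ (t : ℕ) then f t else 1 := by
  rw [← Finset.mul_prod_erase _ _ (Finset.mem_univ (⟨h, hh⟩ : Fin H)),
    ← Finset.mul_prod_erase _ (fun t : Fin H => if h + 1 ≤ (t : ℕ) then f t else 1)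
      (Finset.mem_univ (⟨h, hh⟩ : Fin H))]
  simp only [le_refl, if_true, Nat.not_succ_le_self, if_false, one_mul]
  congr 1
  refine Finset.prod_congr rfl fun t ht => ?_
  have hne : (t : ℕ) ≠ h := fun e => (Finset.mem_erase.1 ht).1 (Fin.ext e)
  congr 1
  exact propext (by omega)

theorem sum_ite_le_eq {H h : ℕ} (hh : h < H) (f : Fin H → ℝ) :
    (∑ t : Fin H, if h ≤ (t : ℕ) then f t else 0) =
      f ⟨h, hh⟩ + ∑ t : Fin H, if h + 1 ≤ (t : ℕ) then f t else 0 := by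
  rw [← Finset.add_sum_erase _ _ (Finset.mem_univ (⟨h, hh⟩ : Fin H)),
    ← Finset.add_sum_erase _ (fun t : Fin H => if h + 1 ≤ (t : ℕ) then f t else 0)
      (Finset.mem_univ (⟨h, hh⟩ : Fin H))]
  simp only [le_refl, if_true, Nat.not_succ_le_self, if_false, zero_add]
  congr 1
  refine Finset.sum_congr rfl fun t ht => ?_
  have hne : (t : ℕ) ≠ h := fun e => (Finset.mem_erase.1 ht).1 (Fin.ext e)
  congr 1
  exact propext (by omega)

/-- Overwrite a trajectory at the times `0, …, h` with the state `s`. -/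
def resetUpTo {S : Type*} {H : ℕ} (h : ℕ) (s : S) (ω : Fin (H + 1) → S) : Fin (H + 1) → S :=
  fun t => if (t : ℕ) ≤ h then s else ω t

theorem resetUpTo_of_le {S : Type*} {H h : ℕ} (s : S) (ω : Fin (H + 1) → S) {t : Fin (H + 1)}
    (ht : (t : ℕ) ≤ h) : resetUpTo h s ω t = s := if_pos ht

theorem resetUpTo_of_lt {S : Type*} {H h : ℕ} (s : S) (ω : Fin (H + 1) → S) {t : Fin (H + 1)}
    (ht : h < (t : ℕ)) : resetUpTo h s ω t = ω t := if_neg ht.not_ge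

variable {S A : Type*} [Fintype S] {H : ℕ}

theorem MDP.qvec_mono (M : MDP S A H) (h : Fin H) (s : S) (a : A) {v w : S → ℝ}
    (hvw : ∀ s', v s' ≤ w s') : M.qvec h s v a ≤ M.qvec h s w a := by
  unfold MDP.qvec
  gcongr with s'
  · exact M.P_nonneg h s a s'
  · exact hvw s'

theorem MDP.qvec_const (M : MDP S A H) (h : Fin H) (s : S) (a : A) (c : ℝ) :
    M.qvec h s (fun _ => c) a = M.r h s a + c := by
  rw [MDP.qvec, ← Finset.sum_mul, M.P_sum, one_mul]

variable [DecidableEq S]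

/-- The expectation of a functional of the trajectory, given `s_h = s`. -/
def MDP.trajExp (M : MDP S A H) (π : Policy S A H) (h : ℕ) (s : S)
    (F : (Fin (H + 1) → S) → ℝ) : ℝ :=
  ∑ ω, M.trajProb π h s ω * F ω

/-- The first-step decomposition of the expectation over trajectories. A trajectory pinned to `s`
up to time `h` that visits `s'` at time `h + 1` corresponds to one pinned to `s'` up to time `h +
1`. -/
theorem MDP.trajExp_step (M : MDP S A H) (π : Policy S A H) {h : ℕ} (hh : h < H) (s : S)
    (F : (Fin (H + 1) → S) → ℝ) :
    M.trajExp π h s F = ∑ s', M.P ⟨h, hh⟩ s (π s ⟨h, hh⟩) s' *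
      M.trajExp π (h + 1) s' fun ω => F (resetUpTo h s ω) := by
  have hlast : h + 1 < H + 1 := by omega
  simp only [MDP.trajExp, MDP.trajProb, ite_mul, zero_mul]
  rw [← Finset.sum_filter, ← Finset.sum_fiberwise _ fun ω => ω ⟨h + 1, hlast⟩]
  refine Finset.sum_congr rfl fun s' _ => ?_
  rw [← Finset.sum_filter, Finset.mul_sum]
  have hback : ∀ ω : Fin (H + 1) → S, (∀ t : Fin (H + 1), (t : ℕ) ≤ h → ω t = s) →
      ω ⟨h + 1, hlast⟩ = s' → resetUpTo h s (resetUpTo (h + 1) s' ω) = ω := by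
    intro ω h1 h2
    ext t
    rcases le_or_gt (t : ℕ) h with ht | ht
    · rw [resetUpTo_of_le _ _ ht, h1 t ht]
    · rw [resetUpTo_of_lt _ _ ht]
      rcases le_or_gt (t : ℕ) (h + 1) with ht' | ht'
      · rw [resetUpTo_of_le _ _ ht', ← h2]
        congr 1
        exact Fin.ext (by simp only; omega)
      · rw [resetUpTo_of_lt _ _ ht']
  refine Finset.sum_nbij' (resetUpTo (h + 1) s') (resetUpTo h s) ?_ ?_ ?_ ?_ ?_
  · intro ω _
    exact Finset.mem_filter.2 ⟨Finset.mem_univ _, fun t ht => resetUpTo_of_le _ _ ht⟩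
  · intro ω hω
    refine Finset.mem_filter.2 ⟨Finset.mem_filter.2 ⟨Finset.mem_univ _, fun t ht =>
      resetUpTo_of_le _ _ ht⟩, ?_⟩
    rw [resetUpTo_of_lt _ _ (by simp)]
    exact (Finset.mem_filter.1 hω).2 _ le_rfl
  · intro ω hω
    have h1 := Finset.mem_filter.1 hω
    exact hback ω (Finset.mem_filter.1 h1.1).2 h1.2
  · intro ω hω
    have h1 := (Finset.mem_filter.1 hω).2
    ext t
    rcases le_or_gt (t : ℕ) (h + 1) with ht | ht
    · rw [resetUpTo_of_le _ _ ht, h1 t ht]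
    · rw [resetUpTo_of_lt _ _ ht, resetUpTo_of_lt _ _ (by omega)]
  · intro ω hω
    have h1 := Finset.mem_filter.1 hω
    have h2 := (Finset.mem_filter.1 h1.1).2
    have h3 : ω ⟨h + 1, hlast⟩ = s' := h1.2
    rw [hback ω h2 h3,
      prod_ite_le_eq hh fun t => M.P t (ω t.castSucc) (π (ω t.castSucc) t) (ω t.succ), ← mul_assoc]
    have e1 : ω (Fin.castSucc ⟨h, hh⟩) = s := h2 _ le_rfl
    have e2 : ω (Fin.succ ⟨h, hh⟩) = s' := h3
    rw [e1, e2]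
    congr 2
    refine Finset.prod_congr rfl fun t _ => ?_
    split_ifs with ht
    · have e3 : resetUpTo (h + 1) s' ω t.castSucc = ω t.castSucc := by
        rcases ht.lt_or_eq with ht' | ht'
        · exact resetUpTo_of_lt _ _ (by simpa using ht')
        · rw [resetUpTo_of_le _ _ (by simpa using ht'.ge), ← h3]
          congr 1
          exact Fin.ext (by simpa using ht')
      have e4 : resetUpTo (h + 1) s' ω t.succ = ω t.succ :=
        resetUpTo_of_lt _ _ (by simp only [Fin.val_succ]; omega)
      rw [e3, e4]
    · rfl

theorem MDP.trajExp_last (M : MDP S A H) (π : Policy S A H) (s : S)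
    (F : (Fin (H + 1) → S) → ℝ) : M.trajExp π H s F = F fun _ => s := by
  rw [MDP.trajExp, Finset.sum_eq_single fun _ => s]
  · rw [MDP.trajProb, if_pos fun _ _ => rfl, Finset.prod_eq_one fun t _ => ?_, one_mul]
    exact if_neg t.2.not_ge
  · intro ω _ hω
    rw [MDP.trajProb, if_neg, zero_mul]
    exact fun h => hω (funext fun t => h t (Nat.lt_succ_iff.1 t.2))
  · simp

theorem MDP.trajExp_const (M : MDP S A H) (π : Policy S A H) {h : ℕ} (hh : h ≤ H) (s : S)
    (c : ℝ) : M.trajExp π h s (fun _ => c) = c := by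
  induction hh using Nat.decreasingInduction generalizing s with
  | self => exact M.trajExp_last π s _
  | of_succ k hk ih =>
    rw [M.trajExp_step π hk]
    simp only [ih, ← Finset.sum_mul, M.P_sum, one_mul]

theorem MDP.V_last (M : MDP S A H) (π : Policy S A H) (s : S) : M.V π H s = 0 := by
  refine Finset.sum_eq_zero fun ω _ => ?_
  rw [Finset.sum_eq_zero fun t _ => if_neg t.2.not_ge, mul_zero]

/-- The Bellman equation of a policy. -/
theorem MDP.V_step (M : MDP S A H) (π : Policy S A H) {h : ℕ} (hh : h < H) (s : S) :
    M.V π h s = M.qvec ⟨h, hh⟩ s (M.V π (h + 1)) (π s ⟨h, hh⟩) := by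
  change M.trajExp π h s _ = _
  rw [M.trajExp_step π hh, MDP.qvec]
  have hF : ∀ ω : Fin (H + 1) → S,
      (∑ t : Fin H, if h ≤ (t : ℕ) then M.r t (resetUpTo h s ω t.castSucc)
        (π (resetUpTo h s ω t.castSucc) t) else 0) =
      M.r ⟨h, hh⟩ s (π s ⟨h, hh⟩) + ∑ t : Fin H, if h + 1 ≤ (t : ℕ) then
        M.r t (ω t.castSucc) (π (ω t.castSucc) t) else 0 := by
    intro ω
    rw [sum_ite_le_eq hh fun t => M.r t (resetUpTo h s ω t.castSucc)
      (π (resetUpTo h s ω t.castSucc) t),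
      resetUpTo_of_le (h := h) (t := Fin.castSucc ⟨h, hh⟩) _ _ le_rfl]
    congr 1
    refine Finset.sum_congr rfl fun t _ => ?_
    split_ifs with ht
    · rw [resetUpTo_of_lt _ _ (by simpa using ht)]
    · rfl
  have hE : ∀ s', (M.trajExp π (h + 1) s' fun ω =>
      ∑ t : Fin H, if h ≤ (t : ℕ) then M.r t (resetUpTo h s ω t.castSucc)
        (π (resetUpTo h s ω t.castSucc) t) else 0) =
      M.r ⟨h, hh⟩ s (π s ⟨h, hh⟩) + M.V π (h + 1) s' := by
    intro s'
    have hc := M.trajExp_const π (show h + 1 ≤ H from hh) s' (M.r ⟨h, hh⟩ s (π s ⟨h, hh⟩))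
    simp only [MDP.trajExp] at hc
    simp only [MDP.trajExp, MDP.V, hF, mul_add, Finset.sum_add_distrib, hc]
  simp only [hE, mul_add, Finset.sum_add_distrib, ← Finset.sum_mul, M.P_sum, one_mul]

/-- The value from time `h` on depends only on the decisions from time `h` on. -/
theorem MDP.V_congr (M : MDP S A H) {π π' : Policy S A H} {h : ℕ} (hh : h ≤ H)
    (heq : ∀ s (t : Fin H), h ≤ (t : ℕ) → π s t = π' s t) : M.V π h = M.V π' h := by
  induction hh using Nat.decreasingInduction with
  | self =>
    ext s
    rw [V_last, V_last]
  | of_succ k hk ih =>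
    ext s
    rw [M.V_step π hk, M.V_step π' hk, ih fun s t ht => heq s t (by omega), heq s ⟨k, hk⟩ le_rfl]

theorem MDP.V_mem_Icc (M : MDP S A H) (π : Policy S A H) {h : ℕ} (hh : h ≤ H) (s : S) :
    M.V π h s ∈ Set.Icc (0 : ℝ) (H - h) := by
  induction hh using Nat.decreasingInduction generalizing s with
  | self => simp [V_last]
  | of_succ k hk ih =>
    rw [M.V_step π hk]
    have h1 := M.qvec_mono ⟨k, hk⟩ s (π s ⟨k, hk⟩) fun s' => (ih s').1
    have h2 := M.qvec_mono ⟨k, hk⟩ s (π s ⟨k, hk⟩) fun s' => (ih s').2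
    rw [M.qvec_const] at h1 h2
    have h3 := M.r_nonneg ⟨k, hk⟩ s (π s ⟨k, hk⟩)
    have h4 := M.r_le_one ⟨k, hk⟩ s (π s ⟨k, hk⟩)
    push_cast at h2
    constructor <;> linarith

variable [Fintype A] [Nonempty A]

theorem MDP.V_le_Vstar (M : MDP S A H) (π : Policy S A H) (h : ℕ) (s : S) :
    M.V π h s ≤ M.Vstar h s :=
  Finset.le_sup' (fun π => M.V π h s) (Finset.mem_univ π)

theorem MDP.Vstar_le (M : MDP S A H) {h : ℕ} {s : S} {c : ℝ} (hc : ∀ π, M.V π h s ≤ c) :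
    M.Vstar h s ≤ c :=
  Finset.sup'_le _ _ fun π _ => hc π

theorem MDP.Vstar_last (M : MDP S A H) : M.Vstar H = 0 := by
  ext s
  refine le_antisymm (M.Vstar_le fun π => (M.V_last π s).le) ?_
  exact (M.V_last _ s).ge.trans (M.V_le_Vstar (fun _ _ => Classical.arbitrary A) H s)

theorem MDP.Vstar_mem_Icc (M : MDP S A H) {h : ℕ} (hh : h ≤ H) (s : S) :
    M.Vstar h s ∈ Set.Icc (0 : ℝ) (H - h) :=
  ⟨(M.V_mem_Icc (fun _ _ => Classical.arbitrary A) hh s).1.trans (M.V_le_Vstar _ h s),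
    M.Vstar_le fun π => (M.V_mem_Icc π hh s).2⟩

/-- Backward induction: a policy that is optimal from time `h + 1` on and greedy at time `h` is
optimal from time `h` on. -/
theorem MDP.V_eq_Vstar_of_greedy (M : MDP S A H) {π : Policy S A H} {h : ℕ} (hh : h < H)
    (hπ : M.V π (h + 1) = M.Vstar (h + 1))
    (hgreedy : ∀ s a, M.qvec ⟨h, hh⟩ s (M.Vstar (h + 1)) a ≤
      M.qvec ⟨h, hh⟩ s (M.Vstar (h + 1)) (π s ⟨h, hh⟩)) :
    M.V π h = M.Vstar h := by
  ext s
  refine le_antisymm (M.V_le_Vstar π h s) (M.Vstar_le fun π' => ?_)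
  rw [M.V_step π hh, M.V_step π' hh, hπ]
  exact (M.qvec_mono _ s _ fun s' => M.V_le_Vstar π' (h + 1) s').trans (hgreedy s _)

theorem MDP.qvec_Vstar_le (M : MDP S A H) (h : Fin H) (s : S) (a : A) :
    M.qvec h s (M.Vstar (h + 1)) a ≤ H := by
  have h1 := M.qvec_mono h s a fun s' => (M.Vstar_mem_Icc (show (h : ℕ) + 1 ≤ H from h.2) s').2
  rw [M.qvec_const] at h1
  have h2 := M.r_le_one h s a
  have h3 : (0 : ℝ) ≤ (h : ℕ) := Nat.cast_nonneg _
  push_cast at h1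
  linarith

/-- With sufficiently many fractional bits, the rounding errors are smaller than all gaps between
different values of the optimal `Q`. -/
theorem MDP.exists_precision (M : MDP S A H) :
    ∃ p₀ : ℕ, ∀ p, p₀ ≤ p → ∀ (h : Fin H) (s : S) (a b : A),
      M.qvec h s (M.Vstar (h + 1)) a < M.qvec h s (M.Vstar (h + 1)) b →
      (Fintype.card S * (H + 1) + 1 : ℝ) <
        2 ^ p * (M.qvec h s (M.Vstar (h + 1)) b - M.qvec h s (M.Vstar (h + 1)) a) := by
  have hev : ∀ᶠ p : ℕ in Filter.atTop, ∀ (h : Fin H) (s : S) (a b : A),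
      M.qvec h s (M.Vstar (h + 1)) a < M.qvec h s (M.Vstar (h + 1)) b →
      (Fintype.card S * (H + 1) + 1 : ℝ) <
        2 ^ p * (M.qvec h s (M.Vstar (h + 1)) b - M.qvec h s (M.Vstar (h + 1)) a) := by
    simp only [Filter.eventually_all]
    intro h s a b hab
    exact ((tendsto_pow_atTop_atTop_of_one_lt one_lt_two).atTop_mul_const
      (sub_pos.2 hab)).eventually_gt_atTop _
  exact Filter.eventually_atTop.1 hev

end DynamicProgramming

/-! ### Correctness of quantum value iteration -/

section Correctness

open scoped ENNReal

variable {S A : Type*} [Fintype S] [DecidableEq S] [Fintype A] [DecidableEq A] [Nonempty A]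
  {H : ℕ}

/-- The policy is optimal from time `h` on, and the value vector is the optimal one at time `h`: the
invariant of the backward recursion. -/
def MDP.OptimalFrom (M : MDP S A H) (h : ℕ) (x : Policy S A H × (S → ℝ)) : Prop :=
  M.V x.1 h = M.Vstar h ∧ x.2 = M.Vstar h

/-- Starting from the optimal `V_{h+1}`, the search for a state `s` misses the greedy actions with
probability at most `ζ`. -/
theorem failProb_qms_qOracle {p q : ℕ} {M : MDP S A H} {O : Gate (MDPReg S A H q)}
    {UV : Gate (S × Word q)} (hO : IsMDPOracle p M O) (h : Fin H)
    (hV : IsBinaryOracle p UV (M.Vstar (h + 1))) (hq : H * 2 ^ p < 2 ^ q)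
    (hp : ∀ (s : S) (a b : A),
      M.qvec h s (M.Vstar (h + 1)) a < M.qvec h s (M.Vstar (h + 1)) b →
      (Fintype.card S * (H + 1) + 1 : ℝ) <
        2 ^ p * (M.qvec h s (M.Vstar (h + 1)) b - M.qvec h s (M.Vstar (h + 1)) a))
    {ζ : ℝ} (hζ : 0 < ζ) (hζ1 : ζ < 1) (s : S) :
    failProb (qms 146 (qOracle p O UV s) (⟨s, h, s, 0, 0, 0, 0⟩ : Anc S H q)
        (fun k => k.acc.val) ζ)
      (fun a => ∀ b, M.qvec h s (M.Vstar (h + 1)) b ≤ M.qvec h s (M.Vstar (h + 1)) a) ≤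
      ENNReal.ofReal ζ := by
  have hh : (h : ℕ) + 1 ≤ H := h.2
  have h0 : ∀ s', 0 ≤ M.Vstar (h + 1) s' := fun s' => (M.Vstar_mem_Icc hh s').1
  have h1 : ∀ s', M.Vstar (h + 1) s' ≤ H := fun s' => by
    have := (M.Vstar_mem_Icc hh s').2
    have : (0 : ℝ) ≤ ((h : ℕ) + 1 : ℕ) := Nat.cast_nonneg _
    linarith
  have hmaps := mapsKet_qOracle hO hV (h := h) (s := s)
  have hval : ∀ a, (Fin.ofNat (2 ^ (2 * q)) (qFixed p q M h s (M.Vstar (h + 1)) a)).val =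
      qFixed p q M h s (M.Vstar (h + 1)) a := fun a => by
    rw [Fin.val_ofNat, Nat.mod_eq_of_lt (qFixed_lt M h s a hq h0 h1 (M.qvec_Vstar_le h s a))]
  refine (failProb_mono fun a _ ha b => ?_).trans (failProb_qms hmaps hζ hζ1)
  by_contra! hlt
  have hab := ha b
  dsimp only at hab
  rw [hval, hval] at hab
  have hab' : (qFixed p q M h s (M.Vstar (h + 1)) b : ℝ) ≤
      qFixed p q M h s (M.Vstar (h + 1)) a := by exact_mod_cast hab
  have e1 := qFixed_le M h s a hq h0 h1
  have e2 := le_qFixed_add M h s b hq h0 h1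
  have e3 := mul_lt_mul_of_pos_left (hp s a b hlt) (by positivity : (0 : ℝ) < 2 ^ p)
  nlinarith

theorem failProb_qviStep {p q : ℕ} {M : MDP S A H} {O : Gate (MDPReg S A H q)}
    {UV : (S → ℝ) → Gate (S × Word q)} (hO : IsMDPOracle p M O)
    (hV : ∀ v, IsBinaryOracle p (UV v) v) (hq : H * 2 ^ p < 2 ^ q) (h : Fin H)
    (hp : ∀ (s : S) (a b : A),
      M.qvec h s (M.Vstar (h + 1)) a < M.qvec h s (M.Vstar (h + 1)) b →
      (Fintype.card S * (H + 1) + 1 : ℝ) <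
        2 ^ p * (M.qvec h s (M.Vstar (h + 1)) b - M.qvec h s (M.Vstar (h + 1)) a))
    {δ : ℝ} (hδ : 0 < δ) (hδ1 : δ < 1) {x : Policy S A H × (S → ℝ)}
    (hx : M.OptimalFrom (h + 1) x) :
    failProb (qviStep 146 p M O UV δ h x) (M.OptimalFrom h) ≤ ENNReal.ofReal (δ / H) := by
  have hH : (1 : ℝ) ≤ H := by exact_mod_cast h.pos
  rw [qviStep, failProb_map, hx.2]
  refine (failProb_mono (good := fun a : S → A => ∀ s b, M.qvec h s (M.Vstar (h + 1)) b ≤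
    M.qvec h s (M.Vstar (h + 1)) (a s)) fun a _ ha => ?_).trans
    ((failProb_indep_le _ fun s a => ∀ b, M.qvec h s (M.Vstar (h + 1)) b ≤
      M.qvec h s (M.Vstar (h + 1)) a).trans ?_)
  · set π' : Policy S A H := fun s t => if t = h then a s else x.1 s t with hπ'
    have hat : ∀ s, π' s h = a s := fun s => if_pos rfl
    have hnext : M.V π' (h + 1) = M.Vstar (h + 1) := by
      rw [← hx.1]
      refine M.V_congr h.2 fun s t ht => if_neg ?_
      rintro rfl
      omega
    have hgood : M.V π' h = M.Vstar h := by
      refine M.V_eq_Vstar_of_greedy h.2 hnext fun s b => ?_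
      rw [Fin.eta, hat]
      exact ha s b
    refine ⟨hgood, ?_⟩
    ext s
    dsimp only
    rw [← hgood, M.V_step π' h.2, Fin.eta, hat, hnext]
  · rcases isEmpty_or_nonempty S with hS | hS
    · simp
    have hS1 : (1 : ℝ) ≤ Fintype.card S := by exact_mod_cast Fintype.card_pos
    have hSH : (1 : ℝ) ≤ Fintype.card S * H := one_le_mul_of_one_le_of_one_le hS1 hH
    have hζ : 0 < δ / (Fintype.card S * H) := by positivity
    have hζ1 : δ / (Fintype.card S * H) < 1 := (div_le_self hδ.le hSH).trans_lt hδ1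
    refine (Finset.sum_le_sum fun s _ =>
      failProb_qms_qOracle hO h (hV _) hq hp hζ hζ1 s).trans ?_
    rw [Finset.sum_const, Finset.card_univ, nsmul_eq_mul, ← ENNReal.ofReal_natCast,
      ← ENNReal.ofReal_mul (Nat.cast_nonneg _)]
    refine ENNReal.ofReal_le_ofReal (le_of_eq ?_)
    have : (Fintype.card S : ℝ) ≠ 0 := by linarith
    field_simp

/-- The backward recursion accumulates a failure probability of `δ / H` per time step. -/
theorem failProb_foldr_qviStep {p q : ℕ} {M : MDP S A H} {O : Gate (MDPReg S A H q)}
    {UV : (S → ℝ) → Gate (S × Word q)} (hO : IsMDPOracle p M O)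
    (hV : ∀ v, IsBinaryOracle p (UV v) v) (hq : H * 2 ^ p < 2 ^ q)
    (hp : ∀ (h : Fin H) (s : S) (a b : A),
      M.qvec h s (M.Vstar (h + 1)) a < M.qvec h s (M.Vstar (h + 1)) b →
      (Fintype.card S * (H + 1) + 1 : ℝ) <
        2 ^ p * (M.qvec h s (M.Vstar (h + 1)) b - M.qvec h s (M.Vstar (h + 1)) a))
    {δ : ℝ} (hδ : 0 < δ) (hδ1 : δ < 1) {k : ℕ} (hk : k ≤ H) :
    failProb (((List.finRange H).drop k).foldr (fun h μ => μ.bind (qviStep 146 p M O UV δ h))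
      (PMF.pure (fun _ _ => Classical.arbitrary A, 0))) (M.OptimalFrom k) ≤
      ENNReal.ofReal ((H - k) * (δ / H)) := by
  induction hk using Nat.decreasingInduction with
  | self =>
    rw [List.drop_eq_nil_of_le (by simp), List.foldr_nil, failProb_eq_zero]
    · exact zero_le
    · intro x hx
      rw [PMF.support_pure, Set.mem_singleton_iff] at hx
      subst hx
      refine ⟨?_, M.Vstar_last.symm⟩
      rw [M.Vstar_last]
      exact funext (M.V_last _)
  | of_succ k hk ih =>
    rw [List.drop_eq_getElem_cons (by simpa using hk), List.foldr_cons, List.getElem_finRange]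
    refine (failProb_bind_le (good := M.OptimalFrom (k + 1)) fun x hx =>
      failProb_qviStep hO hV hq ⟨k, hk⟩ (hp ⟨k, hk⟩) hδ hδ1 hx).trans ?_
    have hkH : ((k + 1 : ℕ) : ℝ) ≤ H := by exact_mod_cast hk
    have hdiv : 0 ≤ δ / H := by positivity
    refine (add_le_add_left ih _).trans ?_
    rw [← ENNReal.ofReal_add (mul_nonneg (by linarith) hdiv) hdiv]
    refine ENNReal.ofReal_le_ofReal (le_of_eq ?_)
    push_cast
    ring

end Correctness

end QVI

theorem mainTheorem2 :
    ∃ c : ℝ, 0 < c ∧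
      ∀ (S A : Type*) [Fintype S] [DecidableEq S] [Fintype A] [DecidableEq A] [Nonempty A]
        (H : ℕ) (M : QVI.MDP S A H),
        ∃ p₀ : ℕ, ∀ p q : ℕ, p₀ ≤ p → H * 2 ^ p < 2 ^ q →
          ∀ (O : QVI.Gate (QVI.MDPReg S A H q)) (UV : (S → ℝ) → QVI.Gate (S × QVI.Word q)),
            QVI.IsMDPOracle p M O → (∀ v, QVI.IsBinaryOracle p (UV v) v) →
            ∀ δ : ℝ, 0 < δ → δ < 1 →
              ENNReal.ofReal (1 - δ) ≤
                (QVI.qvi1 c p M O UV δ).toOuterMeasure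
                  {out | M.IsOptimal out.1 ∧ out.2 = M.Vstar 0} := by
  refine ⟨146, by norm_num, ?_⟩
  intro S A _ _ _ _ _ H M
  obtain ⟨p₀, hp₀⟩ := M.exists_precision
  refine ⟨p₀, fun p q hp hq O UV hO hV δ hδ hδ1 => ?_⟩
  have hfail := QVI.failProb_foldr_qviStep hO hV hq (hp₀ p hp) hδ hδ1 (Nat.zero_le H)
  rw [List.drop_zero] at hfail
  have hle : ((H : ℝ) - (0 : ℕ)) * (δ / H) ≤ δ := by
    rw [Nat.cast_zero, sub_zero]
    rcases eq_or_ne (H : ℝ) 0 with h | h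
    · simpa [h] using hδ.le
    · rw [mul_div_cancel₀ _ h]
  refine le_trans ?_ (QVI.one_sub_failProb_le (QVI.qvi1 146 p M O UV δ) (M.OptimalFrom 0))
  rw [ENNReal.ofReal_sub _ hδ.le, ENNReal.ofReal_one]
  exact tsub_le_tsub_left (hfail.trans (ENNReal.ofReal_le_ofReal hle)) 1
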